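/- Let $p>1$ and let $(X,\mu)$ be a nonatomic probability space. A \emph{tree} on $(X,\mu)$ is a family $\mathcal T$ of measurable subsets of $X$ of positive measure with $X\in\mathcal T$, such that: (a) each $I\in\mathcal T$ has a finite set $\mathcal C(I)\subseteq\mathcal T$ of at least two children, which are subsets of $I$ with pairwise $\mu$-null intersections and with union $I$; (b) $\mathcal T=\bigcup_{m\ge0}\mathcal T_{(m)}$, where $\mathcal T_{(0)}=\{X\}$ and $\mathcal T_{(m+1)}=\bigcup_{I\in\mathcal T_{(m)}}\mathcal C(I)$; (c) $\sup_{I\in\mathcal T_{(m)}}\mu(I)\to0$ as $m\to\infty$; (d) $\mathcal T$ differentiates $L^1$, that is, for every $g\in L^1(\mu)$ and $\mu$-almost every $x$, $\frac1{\mu(I)}\int_I g\,d\mu\to g(x)$ as $\mu(I)\to0$ with $x\in I\in\mathcal T$. Assume that $(X,\mu)$ carries at least one tree. For a tree $\mathcal T$ put $$M_{\mathcal T}\phi(x)=\sup\Big\{\frac1{\mu(I)}\int_I|\phi|\,d\mu:\ x\in I\in\mathcal T\Big\},$$ and call a positive integrable function $w$ on $X$ an $A_p$ weight with respect to $\mathcal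 T$ if $$[w]_{\mathcal T,p}=\sup_{I\in\mathcal T}\frac{\big(\int_I w\,d\mu\big)\big(\int_I w^{-1/(p-1)}\,d\mu\big)^{p-1}}{\mu(I)^p}<\infty.$$ Let $\omega_p:[0,1]\to[1,\frac p{p-1}]$ be the inverse function of $H_p(t)=-(p-1)t^p+pt^{p-1}$, $t\in[1,\frac p{p-1}]$. Let $F,f,z>0$ and $h\ge1$ be real numbers with $z f^p\le hF$. Then there exist a sequence of trees $\mathcal T_m$ on $(X,\mu)$ and two sequences $(\phi_m)$, $(w_m)$ of positive measurable functions on $X$, with $\phi_m$ and $\phi_m^pw_m$ integrable, such that each $w_m$ is an $A_p$ weight with respect to $\mathcal T_m$, $$\int_X\phi_m\,d\mu\to f,\qquad \int_X\phi_m^p w_m\,d\mu\to F,\qquad [w_m]_{\mathcal T_m,p}\to h,\qquad \int_X w_m\,d\mu\to z,$$ and such that the following limit exists, is finite, and satisfies $$\lim_{m\to\infty}\int_X (M_{\mathcal T_m}\phi_m)^p\,w_m\,d\mu\ \ge\ F\,\omega_p\Big(\frac{z f^p}{hF}\Big)^{p}\,\omega_p\Big(\frac1h\Big)^{-p}.$$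 -/

import Mathlib

open MeasureTheory Filter Topology
open scoped ENNReal

namespace DyadicLike

/-- The generations `𝒯₍₀₎ = {X}`, `𝒯₍ₘ₊₁₎ = ⋃_{I ∈ 𝒯₍ₘ₎} C(I)` produced by the children map `C`. -/
def generation {X : Type*} (C : Set X → Set (Set X)) : ℕ → Set (Set X)
  | 0 => {Set.univ}
  | m + 1 => ⋃ I ∈ generation C m, C I

/-- The family `𝒯` differentiates `L¹(μ)`: for every integrable `g` and almost every `x`, the
averages of `g` over the sets `I ∈ 𝒯` containing `x` converge to `g x` as `μ I → 0`. -/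
def DifferentiatesL1 {X : Type*} [MeasurableSpace X] (μ : Measure X) (𝒯 : Set (Set X)) : Prop :=
  ∀ g : X → ℝ, Integrable g μ → ∀ᵐ x ∂μ,
    Tendsto (fun I : Set X => ⨍ y in I, g y ∂μ)
      (comap (fun I : Set X => μ I) (𝓝 0) ⊓ 𝓟 {I | I ∈ 𝒯 ∧ x ∈ I}) (𝓝 (g x))

/-- `𝒯` is a tree on `(X, μ)` with children map `C`. -/
structure IsTreeWith {X : Type*} [MeasurableSpace X] (μ : Measure X) (𝒯 : Set (Set X))
    (C : Set X → Set (Set X)) : Prop where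
  measurableSet : ∀ I ∈ 𝒯, MeasurableSet I
  univ_mem : Set.univ ∈ 𝒯
  measure_pos : ∀ I ∈ 𝒯, 0 < μ I
  children_subset : ∀ I ∈ 𝒯, C I ⊆ 𝒯
  children_finite : ∀ I ∈ 𝒯, (C I).Finite
  children_two_le : ∀ I ∈ 𝒯, 2 ≤ (C I).ncard
  children_almost_disjoint : ∀ I ∈ 𝒯, (C I).Pairwise fun J K => μ (J ∩ K) = 0
  sUnion_children : ∀ I ∈ 𝒯, ⋃₀ C I = I
  eq_iUnion_generation : 𝒯 = ⋃ m, generation C m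
  tendsto_iSup_measure : Tendsto (fun m => ⨆ I ∈ generation C m, μ I) atTop (𝓝 0)
  differentiatesL1 : DifferentiatesL1 μ 𝒯

/-- `𝒯` is a tree on `(X, μ)`. -/
def IsTree {X : Type*} [MeasurableSpace X] (μ : Measure X) (𝒯 : Set (Set X)) : Prop :=
  ∃ C : Set X → Set (Set X), IsTreeWith μ 𝒯 C

/-- The maximal operator
`M_𝒯 φ (x) = sup { μ(I)⁻¹ ∫_I |φ| dμ : x ∈ I ∈ 𝒯 }`, with values in `[0, ∞]`. -/
noncomputable def maximal {X : Type*} [MeasurableSpace X] (μ : Measure X) (𝒯 : Set (Set X))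
    (φ : X → ℝ) (x : X) : ℝ≥0∞ :=
  ⨆ I ∈ 𝒯, ⨆ _ : x ∈ I, (∫⁻ y in I, ‖φ y‖ₑ ∂μ) / μ I

/-- `[w]_{𝒯,p} = sup_{I ∈ 𝒯} w(I) σ(I)^{p-1} / μ(I)^p` with `σ = w^{-1/(p-1)}`,
as an element of `[0, ∞]`. -/
noncomputable def apConst {X : Type*} [MeasurableSpace X] (μ : Measure X) (𝒯 : Set (Set X))
    (p : ℝ) (w : X → ℝ) : ℝ≥0∞ :=
  ⨆ I ∈ 𝒯, (∫⁻ x in I, ENNReal.ofReal (w x) ∂μ) *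
    (∫⁻ x in I, ENNReal.ofReal (w x ^ (-(1 / (p - 1)))) ∂μ) ^ (p - 1) / μ I ^ p

/-- `w` is an `A_p` weight with respect to `𝒯`: a positive measurable integrable function
with finite `A_p` constant. -/
structure IsApWeight {X : Type*} [MeasurableSpace X] (μ : Measure X) (𝒯 : Set (Set X))
    (p : ℝ) (w : X → ℝ) : Prop where
  measurable : Measurable w
  pos : ∀ x, 0 < w x
  integrable : Integrable w μ
  apConst_lt_top : apConst μ 𝒯 p w < ∞

/-- `H_p(t) = -(p-1) t^p + p t^{p-1}`. -/
noncomputable def bellmanH (p t : ℝ) : ℝ := -(p - 1) * t ^ p + p * t ^ (p - 1)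

/-- `ω_p : [0,1] → [1, p/(p-1)]`, the inverse of the restriction of `H_p` to `[1, p/(p-1)]`,
which for `p > 1` is a decreasing bijection onto `[0,1]`. -/
noncomputable def omegaP (p : ℝ) : ℝ → ℝ :=
  Function.invFunOn (bellmanH p) (Set.Icc 1 (p / (p - 1)))

end DyadicLike

namespace DyadicLike

/-! ### Combinatorics of a chain inserted above one generation of a tree. -/

section Sets

variable {X : Type*} {C : Set X → Set (Set X)}

/-! The model extremizer lives on a nested family of sets, one of each measure `ρ ∈ (0, 1]`. With
`ρ(x)` the measure of the smallest set containing `x`, take power functions `φ = f e ρ^(e-1)` and `w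
= z e' ρ^(e'-1)`. The average of `φ` over the set of measure `ρ` is `f ρ^(e-1) = φ / e`, so `M φ ≥ φ
/ e`, and the `A_p` term is the same on every set of the family. Put `t = ω_p(1/h)` and `s = ω_p(z
f^p / (hF))`, and choose `e' = p - (p-1) t` and `e = t / s`. Then `w^(-1/(p-1))` is a multiple of
`ρ^(t-1)`, the `A_p` term is `1 / H_p(t) = h`, the equation `H_p(s) = z f^p / (hF)` turns `∫ φ^p w`
into `F`, and `∫ (φ / e)^p w = F (s / t)^p` is the required bound.

This is made discrete on sets of measure `r^k`, `k ≤ N`, with functions constant on the successive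
rings. The exponent `e` is then replaced by the difference quotient `powSlope e r`, and the model is
recovered as `N → ∞` and then `r → 1` (`exists_geomChain_near`).

A given tree yields trees containing such chains: the small sets of a deep generation are grouped
into nested unions, which replace all earlier generations (`exists_isChainTree`). The measures of
the unions are prescribed only up to a small error. For a fixed finite chain all quantities depend
continuously on these measures, so the error is harmless (`exists_approximation`).

The integral of the maximal function is bounded below by the averages over the chain and above by a
monotone majorant. Both bounds are uniform enough for a subsequence to converge to a finite limit.
-/

theorem mem_generation_succ {m : ℕ} {J : Set X} :
    J ∈ generation C (m + 1) ↔ ∃ I ∈ generation C m, J ∈ C I := by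
  simp [generation]

/-- The children map obtained from `C` by inserting a chain of unions `⋃₀ S k`, `k ≤ N`, between
the whole space and the sets of `S 0`. -/
def chainChildren (C : Set X → Set (Set X)) (N : ℕ) (S : ℕ → Finset (Set X)) (I : Set X) :
    Set (Set X) :=
  {J | (∃ k < N, I = ⋃₀ (S k : Set (Set X)) ∧
      (J = ⋃₀ (S (k + 1) : Set (Set X)) ∨ (J ∈ S k ∧ J ∉ S (k + 1)))) ∨
    (I = ⋃₀ (S N : Set (Set X)) ∧ J ∈ S N) ∨
    ((∀ k ≤ N, I ≠ ⋃₀ (S k : Set (Set X))) ∧ J ∈ C I)}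

/-- The family of sets reached by `chainChildren`. -/
def chainFamily (C : Set X → Set (Set X)) (n N : ℕ) (S : ℕ → Finset (Set X)) : Set (Set X) :=
  {I | (∃ k ≤ N, I = ⋃₀ (S k : Set (Set X))) ∨ ∃ i, n ≤ i ∧ I ∈ generation C i}

theorem chainChildren_of_lt {N : ℕ} {S : ℕ → Finset (Set X)}
    (hinj : ∀ j ≤ N, ∀ k ≤ N, ⋃₀ (S j : Set (Set X)) = ⋃₀ (S k : Set (Set X)) → j = k)
    {k : ℕ} (hk : k < N) :
    chainChildren C N S (⋃₀ (S k : Set (Set X))) =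
      insert (⋃₀ (S (k + 1) : Set (Set X))) (S k \ S (k + 1) : Set (Set X)) := by
  ext J
  simp only [chainChildren, Set.mem_ofPred_eq, Set.mem_insert_iff, Set.mem_sdiff, Finset.mem_coe]
  constructor
  · rintro (⟨j, hj, hjk, h⟩ | ⟨h, -⟩ | ⟨h, -⟩)
    · obtain rfl := hinj k hk.le j hj.le hjk
      exact h
    · exact absurd (hinj k hk.le N le_rfl h) hk.ne
    · exact absurd rfl (h k hk.le)
  · exact fun h => Or.inl ⟨k, hk, rfl, h⟩

theorem chainChildren_last {N : ℕ} {S : ℕ → Finset (Set X)}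
    (hinj : ∀ j ≤ N, ∀ k ≤ N, ⋃₀ (S j : Set (Set X)) = ⋃₀ (S k : Set (Set X)) → j = k) :
    chainChildren C N S (⋃₀ (S N : Set (Set X))) = (S N : Set (Set X)) := by
  ext J
  rw [Finset.mem_coe]
  constructor
  · rintro (⟨j, hj, hjk, h⟩ | ⟨-, h⟩ | ⟨h, -⟩)
    · exact absurd (hinj N le_rfl j hj.le hjk) hj.ne'
    · exact h
    · exact absurd rfl (h N le_rfl)
  · exact fun h => Or.inr (Or.inl ⟨rfl, h⟩)

theorem chainChildren_of_ne {N : ℕ} {S : ℕ → Finset (Set X)} {I : Set X}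
    (hI : ∀ k ≤ N, I ≠ ⋃₀ (S k : Set (Set X))) : chainChildren C N S I = C I := by
  ext J
  simp only [chainChildren, Set.mem_ofPred_eq]
  constructor
  · rintro (⟨j, hj, hjk, h⟩ | ⟨h, -⟩ | ⟨-, h⟩)
    · exact absurd hjk (hI j hj.le)
    · exact absurd h (hI N le_rfl)
    · exact h
  · exact fun h => Or.inr (Or.inr ⟨hI, h⟩)

theorem exists_mem_notMem_succ {N : ℕ} {S : ℕ → Finset (Set X)} (hlast : S (N + 1) = ∅)
    {J : Set X} (hJ : J ∈ S 0) : ∃ k ≤ N, J ∈ S k ∧ J ∉ S (k + 1) := by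
  by_contra! hcon
  have : ∀ k ≤ N + 1, J ∈ S k := by
    intro k
    induction k with
    | zero => exact fun _ => hJ
    | succ k ih => exact fun hk => hcon k (by omega) (ih (by omega))
  simpa [hlast] using this (N + 1) le_rfl

end Sets

/-- Greedy filling: the elements are added in a fixed order for as long as the total stays at most
`x`, so the defect is less than one element. The fixed order makes the selections nested, which is
what a chain needs. -/
theorem exists_monotone_sum_near {ι : Type*} [DecidableEq ι] (q : ι → ℝ) {δ : ℝ} (hδ : 0 < δ)
    (S : Finset ι) (hq : ∀ i ∈ S, 0 < q i ∧ q i < δ) :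
    ∃ A : ℝ → Finset ι, (∀ x, A x ⊆ S) ∧ Monotone A ∧ (∀ x, ∑ i ∈ S, q i ≤ x → A x = S) ∧
      ∀ x, 0 ≤ x → x ≤ ∑ i ∈ S, q i → x - δ < ∑ i ∈ A x, q i ∧ ∑ i ∈ A x, q i ≤ x := by
  induction S using Finset.induction_on with
  | empty =>
    refine ⟨fun _ => ∅, fun _ => subset_rfl, monotone_const, fun _ _ => rfl, fun x h0 h1 => ?_⟩
    simp only [Finset.sum_empty] at h1 ⊢
    constructor <;> linarith
  | insert i S hi ih =>
    obtain ⟨A, hAS, hmono, htop, hA⟩ := ih fun j hj => hq j (Finset.mem_insert_of_mem hj)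
    obtain ⟨hqi, hqi'⟩ := hq i (Finset.mem_insert_self i S)
    refine ⟨fun x => if x < ∑ j ∈ S, q j then A x else if x < ∑ j ∈ insert i S, q j then S
      else insert i S, fun x => ?_, fun x y hxy => ?_, fun x hx => ?_, fun x h0 h1 => ?_⟩
    · dsimp only
      split_ifs
      · exact (hAS x).trans (Finset.subset_insert i S)
      · exact Finset.subset_insert i S
      · exact subset_rfl
    · dsimp only
      split_ifs
      · exact hmono hxy
      · exact hAS x
      · exact (hAS x).trans (Finset.subset_insert i S)
      · linarith
      · exact le_rfl
      · exact Finset.subset_insert i S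
      · linarith
      · linarith
      · exact le_rfl
    · dsimp only
      rw [Finset.sum_insert hi] at hx ⊢
      rw [if_neg (by linarith), if_neg (by linarith)]
    · rw [Finset.sum_insert hi] at h1 ⊢
      dsimp only
      split_ifs with h2 h3
      · exact hA x h0 h2.le
      · constructor <;> linarith
      · rw [Finset.sum_insert hi]
        constructor <;> linarith

/-! ### Trees beginning with a chain of prescribed measures. -/

section Tree

variable {X : Type*} [MeasurableSpace X] {μ : Measure X} {𝒯 : Set (Set X)}
  {C : Set X → Set (Set X)}

theorem IsTreeWith.generation_subset (hT : IsTreeWith μ 𝒯 C) (m : ℕ) : generation C m ⊆ 𝒯 := by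
  rw [hT.eq_iUnion_generation]
  exact Set.subset_iUnion _ m

theorem IsTreeWith.finite_generation (hT : IsTreeWith μ 𝒯 C) (m : ℕ) :
    (generation C m).Finite := by
  induction m with
  | zero => exact Set.finite_singleton _
  | succ m ih =>
    exact ih.biUnion fun I hI => hT.children_finite I (hT.generation_subset m hI)

theorem IsTreeWith.subset_of_mem_children (hT : IsTreeWith μ 𝒯 C) {I J : Set X} (hI : I ∈ 𝒯)
    (hJ : J ∈ C I) : J ⊆ I := by
  conv_rhs => rw [← hT.sUnion_children I hI]
  exact Set.subset_sUnion_of_mem hJ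

theorem IsTreeWith.sUnion_generation (hT : IsTreeWith μ 𝒯 C) (m : ℕ) :
    ⋃₀ generation C m = Set.univ := by
  induction m with
  | zero => simp [generation]
  | succ m ih =>
    refine Set.eq_univ_of_forall fun x => ?_
    have hx : x ∈ ⋃₀ generation C m := ih ▸ Set.mem_univ x
    obtain ⟨I, hI, hxI⟩ := hx
    rw [← hT.sUnion_children I (hT.generation_subset m hI)] at hxI
    obtain ⟨J, hJ, hxJ⟩ := hxI
    exact ⟨J, mem_generation_succ.2 ⟨I, hI, hJ⟩, hxJ⟩

theorem IsTreeWith.pairwise_aedisjoint_generation (hT : IsTreeWith μ 𝒯 C) (m : ℕ) :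
    (generation C m).Pairwise (AEDisjoint μ) := by
  induction m with
  | zero => exact Set.pairwise_singleton _ _
  | succ m ih =>
    intro J hJ K hK hne
    obtain ⟨I, hI, hJI⟩ := mem_generation_succ.1 hJ
    obtain ⟨I', hI', hKI⟩ := mem_generation_succ.1 hK
    have hI𝒯 := hT.generation_subset m hI
    have hI𝒯' := hT.generation_subset m hI'
    by_cases h : I = I'
    · subst h
      exact hT.children_almost_disjoint I hI𝒯 hJI hKI hne
    · exact (ih hI hI' h).mono (hT.subset_of_mem_children hI𝒯 hJI)
        (hT.subset_of_mem_children hI𝒯' hKI)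

theorem IsTreeWith.exists_ancestor (hT : IsTreeWith μ 𝒯 C) {n i : ℕ} (hni : n ≤ i) {J : Set X}
    (hJ : J ∈ generation C i) : ∃ I ∈ generation C n, J ⊆ I := by
  induction i, hni using Nat.le_induction generalizing J with
  | base => exact ⟨J, hJ, subset_rfl⟩
  | succ i _ ih =>
    obtain ⟨K, hK, hJK⟩ := mem_generation_succ.1 hJ
    obtain ⟨I, hI, hKI⟩ := ih hK
    exact ⟨I, hI, (hT.subset_of_mem_children (hT.generation_subset i hK) hJK).trans hKI⟩

theorem IsTreeWith.exists_measure_generation_lt (hT : IsTreeWith μ 𝒯 C) {ε : ℝ≥0∞} (hε : 0 < ε) :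
    ∃ n, ∀ i, n ≤ i → ∀ J ∈ generation C i, μ J < ε := by
  obtain ⟨n, hn⟩ := eventually_atTop.1 (hT.tendsto_iSup_measure.eventually (gt_mem_nhds hε))
  exact ⟨n, fun i hi J hJ => (le_iSup₂ (f := fun I (_ : I ∈ generation C i) => μ I) J hJ).trans_lt
    (hn i hi)⟩

theorem IsTreeWith.aedisjoint_sUnion (hT : IsTreeWith μ 𝒯 C) {n : ℕ} {S : Finset (Set X)}
    {J : Set X} (hJ : J ∈ generation C n) (hS : (S : Set (Set X)) ⊆ generation C n)
    (hJS : J ∉ S) : AEDisjoint μ J (⋃₀ (S : Set (Set X))) := by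
  rw [AEDisjoint, Set.sUnion_eq_biUnion, Set.inter_iUnion₂]
  refine (measure_biUnion_null_iff S.countable_toSet).2 fun K hK => ?_
  refine hT.pairwise_aedisjoint_generation n hJ (hS hK) ?_
  rintro rfl
  exact hJS hK

theorem IsTreeWith.measureReal_pos [IsFiniteMeasure μ] (hT : IsTreeWith μ 𝒯 C) {n : ℕ}
    {J : Set X} (hJ : J ∈ generation C n) : 0 < μ.real J :=
  ENNReal.toReal_pos (hT.measure_pos J (hT.generation_subset n hJ)).ne' (measure_ne_top μ J)

theorem IsTreeWith.measure_sUnion_finset (hT : IsTreeWith μ 𝒯 C) {n : ℕ} {S : Finset (Set X)}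
    (hS : (S : Set (Set X)) ⊆ generation C n) : μ (⋃₀ (S : Set (Set X))) = ∑ I ∈ S, μ I := by
  rw [Set.sUnion_eq_biUnion]
  exact measure_biUnion_finset₀ ((hT.pairwise_aedisjoint_generation n).mono hS)
    fun I hI => (hT.measurableSet I (hT.generation_subset n (hS hI))).nullMeasurableSet

theorem IsTreeWith.measureReal_sUnion_finset [IsFiniteMeasure μ] (hT : IsTreeWith μ 𝒯 C) {n : ℕ}
    {S : Finset (Set X)} (hS : (S : Set (Set X)) ⊆ generation C n) :
    μ.real (⋃₀ (S : Set (Set X))) = ∑ I ∈ S, μ.real I := by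
  simp only [measureReal_def, hT.measure_sUnion_finset hS]
  exact ENNReal.toReal_sum fun I _ => measure_ne_top μ I

/-- A tree whose sets are either the superlevel sets of `κ`, or sets on which `κ` is almost
everywhere equal to its minimum. -/
structure IsChainTree (μ : Measure X) (𝒯 : Set (Set X)) (N : ℕ) (κ : X → ℕ) : Prop where
  isTree : IsTree μ 𝒯
  measurable : Measurable κ
  le : ∀ x, κ x ≤ N
  superlevel_mem : ∀ k ≤ N, {x | k ≤ κ x} ∈ 𝒯
  dichotomy : ∀ I ∈ 𝒯, (∃ k ≤ N, I = {x | k ≤ κ x}) ∨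
    ∃ k ≤ N, (∀ x ∈ I, k ≤ κ x) ∧ ∀ᵐ x ∂μ.restrict I, κ x = k

theorem measure_sUnion_anti {n N : ℕ} {S : ℕ → Finset (Set X)} (hT : IsTreeWith μ 𝒯 C)
    [IsFiniteMeasure μ]
    (hanti : Antitone S) (hS0 : (S 0 : Set (Set X)) = generation C n)
    (hss : ∀ k ≤ N, S (k + 1) ⊂ S k) {j k : ℕ} (hjk : j < k) (hk : k ≤ N + 1) :
    μ.real (⋃₀ (S k : Set (Set X))) < μ.real (⋃₀ (S j : Set (Set X))) := by
  have hsub : ∀ k, (S k : Set (Set X)) ⊆ generation C n := fun k => by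
    rw [← hS0]
    exact_mod_cast hanti (Nat.zero_le k)
  rw [hT.measureReal_sUnion_finset (hsub k), hT.measureReal_sUnion_finset (hsub j)]
  obtain ⟨J, hJ, hJ'⟩ := Finset.exists_of_ssubset (hss j (by omega))
  refine Finset.sum_lt_sum_of_subset (hanti hjk.le) hJ (fun h => hJ' (hanti hjk h)) ?_
    fun _ _ _ => measureReal_nonneg
  exact hT.measureReal_pos (hsub j hJ)

/-- The union of `S k` splits into the union of `S (k + 1)` and the individual sets dropped on the
way; the last union splits into its members, and below generation `n` the old tree is kept. By `hss`
the unions have strictly decreasing measure, and by `hbig` none of them is an old set kept in the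
family, so the three clauses of `chainChildren` never conflict. Shrinking and differentiation
concern only small sets, which are all inherited. -/
theorem isTreeWith_chainFamily [IsFiniteMeasure μ] (hT : IsTreeWith μ 𝒯 C) {n N : ℕ}
    {S : ℕ → Finset (Set X)} (hanti : Antitone S) (hS0 : (S 0 : Set (Set X)) = generation C n)
    (hlast : S (N + 1) = ∅) (hss : ∀ k ≤ N, S (k + 1) ⊂ S k) (hcard : 2 ≤ (S N).card)
    (hbig : ∀ i, n ≤ i → ∀ J ∈ generation C i, μ J < μ (⋃₀ (S N : Set (Set X)))) :
    IsTreeWith μ (chainFamily C n N S) (chainChildren C N S) := by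
  have hsub : ∀ k, (S k : Set (Set X)) ⊆ generation C n := fun k => by
    rw [← hS0]
    exact_mod_cast hanti (Nat.zero_le k)
  have hinj : ∀ j ≤ N, ∀ k ≤ N, ⋃₀ (S j : Set (Set X)) = ⋃₀ (S k : Set (Set X)) → j = k := by
    intro j hj k hk h
    rcases lt_trichotomy j k with hlt | heq | hlt
    · exact absurd (congrArg μ.real h)
        (measure_sUnion_anti hT hanti hS0 hss hlt (by omega)).ne'
    · exact heq
    · exact absurd (congrArg μ.real h)
        (measure_sUnion_anti hT hanti hS0 hss hlt (by omega)).ne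
  have hle : ∀ k ≤ N, μ (⋃₀ (S N : Set (Set X))) ≤ μ (⋃₀ (S k : Set (Set X))) := fun k hk =>
    measure_mono (Set.sUnion_subset_sUnion (by exact_mod_cast hanti hk))
  have hne : ∀ i, n ≤ i → ∀ J ∈ generation C i, ∀ k ≤ N, J ≠ ⋃₀ (S k : Set (Set X)) := by
    intro i hi J hJ k hk h
    exact absurd ((hle k hk).trans_lt (h ▸ hbig i hi J hJ : _)) (lt_irrefl _)
  have huniv : ⋃₀ (S 0 : Set (Set X)) = Set.univ := by rw [hS0, hT.sUnion_generation]
  have hcases : ∀ I ∈ chainFamily C n N S, (∃ k < N, I = ⋃₀ (S k : Set (Set X))) ∨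
      I = ⋃₀ (S N : Set (Set X)) ∨ ∃ i, n ≤ i ∧ I ∈ generation C i := by
    rintro I (⟨k, hk, h⟩ | h)
    · rcases hk.lt_or_eq with hk | rfl
      · exact Or.inl ⟨k, hk, h⟩
      · exact Or.inr (Or.inl h)
    · exact Or.inr (Or.inr h)
  have hmem : ∀ k ≤ N, ⋃₀ (S k : Set (Set X)) ∈ chainFamily C n N S :=
    fun k hk => Or.inl ⟨k, hk, rfl⟩
  have hgmem : ∀ i, n ≤ i → generation C i ⊆ chainFamily C n N S :=
    fun i hi I hI => Or.inr ⟨i, hi, hI⟩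
  -- The chain delays an old generation by at most `N + 1` steps beyond `n`, so deep new generations
  -- consist of deep old sets.
  have hgen : ∀ m, generation (chainChildren C N S) m ⊆
      {I | (m ≤ N ∧ I = ⋃₀ (S m : Set (Set X))) ∨
        ∃ i, n ≤ i ∧ n + m ≤ i + N + 1 ∧ I ∈ generation C i} := by
    intro m
    induction m with
    | zero =>
      rintro I rfl
      exact Or.inl ⟨Nat.zero_le N, huniv.symm⟩
    | succ m ih =>
      intro J hJ
      obtain ⟨I, hI, hJI⟩ := mem_generation_succ.1 hJ
      rcases ih hI with ⟨hm, rfl⟩ | ⟨i, hi, him, hIi⟩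
      · rcases hm.lt_or_eq with hm | rfl
        · rw [chainChildren_of_lt hinj hm] at hJI
          rcases hJI with rfl | hJI
          · exact Or.inl ⟨hm, rfl⟩
          · exact Or.inr ⟨n, le_rfl, by omega, hsub m hJI.1⟩
        · rw [chainChildren_last hinj] at hJI
          exact Or.inr ⟨n, le_rfl, by omega, hsub m hJI⟩
      · rw [chainChildren_of_ne (hne i hi I hIi)] at hJI
        exact Or.inr ⟨i + 1, by omega, by omega, mem_generation_succ.2 ⟨I, hIi, hJI⟩⟩
  have hgenS : ∀ k ≤ N, ⋃₀ (S k : Set (Set X)) ∈ generation (chainChildren C N S) k := by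
    intro k
    induction k with
    | zero => exact fun _ => huniv
    | succ k ih =>
      intro hk
      refine mem_generation_succ.2 ⟨_, ih (by omega), ?_⟩
      rw [chainChildren_of_lt hinj (by omega)]
      exact Set.mem_insert _ _
  have hgenC : ∀ i, n ≤ i → generation C i ⊆ ⋃ m, generation (chainChildren C N S) m := by
    intro i hi
    induction i, hi using Nat.le_induction with
    | base =>
      intro J hJ
      obtain ⟨k, hk, hJk, hJk'⟩ := exists_mem_notMem_succ hlast
        (by rw [← Finset.mem_coe, hS0]; exact hJ : J ∈ S 0)
      refine Set.mem_iUnion.2 ⟨k + 1, mem_generation_succ.2 ⟨_, hgenS k hk, ?_⟩⟩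
      rcases hk.lt_or_eq with hk | rfl
      · rw [chainChildren_of_lt hinj hk]
        exact Or.inr ⟨hJk, hJk'⟩
      · rw [chainChildren_last hinj]
        exact hJk
    | succ i hi ih =>
      intro J hJ
      obtain ⟨I, hI, hJI⟩ := mem_generation_succ.1 hJ
      obtain ⟨m, hm⟩ := Set.mem_iUnion.1 (ih hI)
      refine Set.mem_iUnion.2 ⟨m + 1, mem_generation_succ.2 ⟨I, hm, ?_⟩⟩
      rwa [chainChildren_of_ne (hne i hi I hI)]
  have hSN : ∀ k ≤ N, (S k).Nonempty := fun k hk =>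
    Finset.card_pos.1 (by
      have := Finset.card_le_card (hanti hk)
      omega)
  refine ⟨?_, ?_, ?_, ?_, ?_, ?_, ?_, ?_, ?_, ?_, ?_⟩
  · rintro I (⟨k, hk, rfl⟩ | ⟨i, hi, hI⟩)
    · exact MeasurableSet.sUnion (S k).countable_toSet
        fun J hJ => hT.measurableSet J (hT.generation_subset n (hsub k hJ))
    · exact hT.measurableSet I (hT.generation_subset i hI)
  · rw [← huniv]
    exact hmem 0 (Nat.zero_le N)
  · rintro I (⟨k, hk, rfl⟩ | ⟨i, hi, hI⟩)
    · obtain ⟨J, hJ⟩ := hSN k hk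
      exact (hT.measure_pos J (hT.generation_subset n (hsub k hJ))).trans_le
        (measure_mono (Set.subset_sUnion_of_mem hJ))
    · exact hT.measure_pos I (hT.generation_subset i hI)
  · intro I hI
    rcases hcases I hI with ⟨k, hk, rfl⟩ | rfl | ⟨i, hi, hIi⟩
    · rw [chainChildren_of_lt hinj hk]
      rintro J (rfl | hJ)
      · exact hmem (k + 1) hk
      · exact hgmem n le_rfl (hsub k hJ.1)
    · rw [chainChildren_last hinj]
      exact (hsub N).trans (hgmem n le_rfl)
    · rw [chainChildren_of_ne (hne i hi I hIi)]
      exact fun J hJ => hgmem (i + 1) (by omega) (mem_generation_succ.2 ⟨I, hIi, hJ⟩)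
  · intro I hI
    rcases hcases I hI with ⟨k, hk, rfl⟩ | rfl | ⟨i, hi, hIi⟩
    · rw [chainChildren_of_lt hinj hk]
      exact ((S k).finite_toSet.sdiff).insert _
    · rw [chainChildren_last hinj]
      exact (S N).finite_toSet
    · rw [chainChildren_of_ne (hne i hi I hIi)]
      exact hT.children_finite I (hT.generation_subset i hIi)
  · intro I hI
    rcases hcases I hI with ⟨k, hk, rfl⟩ | rfl | ⟨i, hi, hIi⟩
    · rw [chainChildren_of_lt hinj hk, Set.ncard_insert_of_notMem]
      · obtain ⟨J, hJ, hJ'⟩ := Finset.exists_of_ssubset (hss k hk.le)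
        have : 0 < ((S k : Set (Set X)) \ S (k + 1)).ncard :=
          (Set.ncard_pos (S k).finite_toSet.sdiff).2 ⟨J, hJ, hJ'⟩
        exact Nat.succ_le_succ this
      · exact fun h => hne n le_rfl _ (hsub k h.1) (k + 1) hk rfl
    · rw [chainChildren_last hinj, Set.ncard_coe_finset]
      exact hcard
    · rw [chainChildren_of_ne (hne i hi I hIi)]
      exact hT.children_two_le I (hT.generation_subset i hIi)
  · intro I hI
    rcases hcases I hI with ⟨k, hk, rfl⟩ | rfl | ⟨i, hi, hIi⟩
    · rw [chainChildren_of_lt hinj hk]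
      have key : ∀ J ∈ (S k : Set (Set X)) \ S (k + 1),
          AEDisjoint μ J (⋃₀ (S (k + 1) : Set (Set X))) := by
        intro J hJ
        exact hT.aedisjoint_sUnion (hsub k hJ.1) (hsub (k + 1)) hJ.2
      rintro J hJ K hK hJK
      rcases hJ with rfl | hJ <;> rcases hK with rfl | hK
      · exact absurd rfl hJK
      · exact (key K hK).symm
      · exact key J hJ
      · exact hT.pairwise_aedisjoint_generation n (hsub k hJ.1) (hsub k hK.1) hJK
    · rw [chainChildren_last hinj]
      exact (hT.pairwise_aedisjoint_generation n).mono (hsub N)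
    · rw [chainChildren_of_ne (hne i hi I hIi)]
      exact hT.children_almost_disjoint I (hT.generation_subset i hIi)
  · intro I hI
    rcases hcases I hI with ⟨k, hk, rfl⟩ | rfl | ⟨i, hi, hIi⟩
    · rw [chainChildren_of_lt hinj hk, Set.sUnion_insert, ← Set.sUnion_union,
        Set.union_sdiff_cancel (by exact_mod_cast hanti (Nat.le_succ k))]
    · rw [chainChildren_last hinj]
    · rw [chainChildren_of_ne (hne i hi I hIi)]
      exact hT.sUnion_children I (hT.generation_subset i hIi)
  · refine Set.Subset.antisymm ?_ (Set.iUnion_subset fun m I hI => ?_)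
    · rintro I (⟨k, hk, rfl⟩ | ⟨i, hi, hI⟩)
      · exact Set.mem_iUnion.2 ⟨k, hgenS k hk⟩
      · exact hgenC i hi hI
    · rcases hgen m hI with ⟨hm, rfl⟩ | ⟨i, hi, -, hI⟩
      · exact hmem m hm
      · exact hgmem i hi hI
  · refine ENNReal.tendsto_atTop_zero.2 fun ε hε => ?_
    obtain ⟨M, hM⟩ := hT.exists_measure_generation_lt hε
    refine ⟨M + N + 1, fun m hm => iSup₂_le fun I hI => ?_⟩
    rcases hgen m hI with ⟨hm', -⟩ | ⟨i, hi, him, hI⟩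
    · omega
    · exact (hM i (by omega) I hI).le
  · intro g hg
    filter_upwards [hT.differentiatesL1 g hg] with x hx
    -- Sets of measure below that of the innermost union are not chain sets, so near measure zero
    -- the filter sees only old tree sets.
    refine hx.mono_left (le_inf inf_le_left (le_principal_iff.2 ?_))
    obtain ⟨J, hJ⟩ := hSN N le_rfl
    have hpos : 0 < μ (⋃₀ (S N : Set (Set X))) :=
      (hT.measure_pos J (hT.generation_subset n (hsub N hJ))).trans_le
        (measure_mono (Set.subset_sUnion_of_mem hJ))
    have h1 : {I : Set X | μ I < μ (⋃₀ (S N : Set (Set X)))} ∈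
        comap (fun I : Set X => μ I) (𝓝 0) ⊓ 𝓟 {I | I ∈ chainFamily C n N S ∧ x ∈ I} :=
      mem_inf_of_left (preimage_mem_comap (gt_mem_nhds hpos))
    have h2 : {I | I ∈ chainFamily C n N S ∧ x ∈ I} ∈
        comap (fun I : Set X => μ I) (𝓝 0) ⊓ 𝓟 {I | I ∈ chainFamily C n N S ∧ x ∈ I} :=
      mem_inf_of_right (mem_principal_self _)
    filter_upwards [h1, h2] with I hI1 hI2
    refine ⟨?_, hI2.2⟩
    rcases hI2.1 with ⟨k, hk, rfl⟩ | ⟨i, hi, hI⟩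
    · exact absurd (hle k hk) (not_le.2 hI1)
    · exact hT.generation_subset i hI

theorem exists_isChainTree_of_finset [IsFiniteMeasure μ] (hT : IsTreeWith μ 𝒯 C) {n N : ℕ}
    {S : ℕ → Finset (Set X)} (hanti : Antitone S) (hS0 : (S 0 : Set (Set X)) = generation C n)
    (hlast : S (N + 1) = ∅) (hss : ∀ k ≤ N, S (k + 1) ⊂ S k) (hcard : 2 ≤ (S N).card)
    (hbig : ∀ i, n ≤ i → ∀ J ∈ generation C i, μ J < μ (⋃₀ (S N : Set (Set X)))) :
    ∃ (𝒯' : Set (Set X)) (κ : X → ℕ), IsChainTree μ 𝒯' N κ ∧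
      ∀ k, {x | k ≤ κ x} = ⋃₀ (S k : Set (Set X)) := by
  classical
  have hTree := isTreeWith_chainFamily hT hanti hS0 hlast hss hcard hbig
  have huniv : ⋃₀ (S 0 : Set (Set X)) = Set.univ := by rw [hS0, hT.sUnion_generation]
  have hsub : ∀ k, (S k : Set (Set X)) ⊆ generation C n := fun k => by
    rw [← hS0]
    exact_mod_cast hanti (Nat.zero_le k)
  let κ : X → ℕ := fun x => Nat.findGreatest (fun k => x ∈ ⋃₀ (S k : Set (Set X))) N
  have hκN : ∀ x, κ x ≤ N := fun x => Nat.findGreatest_le N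
  have hκ : ∀ k, {x | k ≤ κ x} = ⋃₀ (S k : Set (Set X)) := by
    intro k
    ext x
    constructor
    · intro hk
      have hspec : x ∈ ⋃₀ (S (κ x) : Set (Set X)) :=
        Nat.findGreatest_spec (P := fun k => x ∈ ⋃₀ (S k : Set (Set X))) (Nat.zero_le N)
          (huniv ▸ Set.mem_univ x)
      exact Set.sUnion_subset_sUnion (by exact_mod_cast hanti hk) hspec
    · intro hx
      rcases le_or_gt k N with hk | hk
      · exact Nat.le_findGreatest hk hx
      · have : S k = ∅ := Finset.subset_empty.1 (hlast ▸ hanti hk)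
        simp [this] at hx
  refine ⟨chainFamily C n N S, κ, ⟨⟨_, hTree⟩, ?_, hκN, ?_, ?_⟩, hκ⟩
  · refine measurable_of_Ici fun k => ?_
    have : κ ⁻¹' Set.Ici k = ⋃₀ (S k : Set (Set X)) := hκ k
    rw [this]
    exact MeasurableSet.sUnion (S k).countable_toSet
        fun J hJ => hT.measurableSet J (hT.generation_subset n (hsub k hJ))
  · intro k hk
    rw [hκ k]
    exact Or.inl ⟨k, hk, rfl⟩
  · rintro I (⟨k, hk, rfl⟩ | ⟨i, hi, hI⟩)
    · exact Or.inl ⟨k, hk, (hκ k).symm⟩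
    · obtain ⟨J, hJ, hIJ⟩ := hT.exists_ancestor hi hI
      obtain ⟨k, hk, hJk, hJk'⟩ := exists_mem_notMem_succ hlast
        (by rw [← Finset.mem_coe, hS0]; exact hJ : J ∈ S 0)
      -- This bound holds at every point, whereas equality can fail on the null overlaps of sets of
      -- generation `n`. There `κ` can only be larger.
      have hIk : ∀ x ∈ I, k ≤ κ x := fun x hx => by
        have : x ∈ {x | k ≤ κ x} := by
          rw [hκ k]
          exact Set.subset_sUnion_of_mem hJk (hIJ hx)
        exact this
      refine Or.inr ⟨k, hk, hIk, ?_⟩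
      have hdisj : AEDisjoint μ J (⋃₀ (S (k + 1) : Set (Set X))) :=
        hT.aedisjoint_sUnion hJ (hsub (k + 1)) hJk'
      rw [ae_restrict_iff' (hT.measurableSet I (hT.generation_subset i hI))]
      refine measure_mono_null (fun x hx => ?_) hdisj
      simp only [Set.mem_compl_iff, Set.mem_ofPred_eq, Classical.not_imp] at hx
      refine ⟨hIJ hx.1, ?_⟩
      rw [← hκ (k + 1)]
      exact lt_of_le_of_ne (hIk x hx.1) (Ne.symm hx.2)

/-- A generation of sufficiently small sets is filled greedily to the levels `a k`. Nonatomicity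
enters only through the smallness of the sets of the tree. -/
theorem exists_isChainTree [IsProbabilityMeasure μ] (hT : IsTree μ 𝒯) {N : ℕ} {a : ℕ → ℝ}
    (ha0 : a 0 = 1) (ha : ∀ k ≤ N, a (k + 1) < a k) (haN : ∀ k, N < k → a k = 0) {δ : ℝ}
    (hδ : 0 < δ) :
    ∃ (𝒯' : Set (Set X)) (κ : X → ℕ), IsChainTree μ 𝒯' N κ ∧
      ∀ k, |μ.real {x | k ≤ κ x} - a k| < δ := by
  classical
  obtain ⟨C, hT⟩ := hT
  have hanti : Antitone a := antitone_nat_of_succ_le fun k => by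
    rcases le_or_gt k N with hk | hk
    · exact (ha k hk).le
    · rw [haN k hk, haN (k + 1) (by omega)]
  have ha_nonneg : ∀ k, 0 ≤ a k := fun k => by
    rw [← haN (max k N + 1) (by omega)]
    exact hanti (by omega)
  have ha_le : ∀ k, a k ≤ 1 := fun k => ha0 ▸ hanti (Nat.zero_le k)
  -- A third of the least gap: after an error of at most `η`, the inclusions remain strict and the
  -- last union still has measure above twice the size of any single set.
  obtain ⟨η, hη, hgap⟩ : ∃ η : ℝ, 0 < η ∧ ∀ k ≤ N, 3 * η ≤ a k - a (k + 1) := by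
    obtain ⟨j, hj, hmin⟩ := (Finset.range (N + 1)).exists_min_image
      (fun k => a k - a (k + 1)) ⟨0, by simp⟩
    refine ⟨(a j - a (j + 1)) / 3, ?_, fun k hk => ?_⟩
    · have := ha j (by simpa [Nat.lt_succ_iff] using hj)
      linarith
    · have := hmin k (by simpa [Nat.lt_succ_iff] using hk)
      linarith
  let δ' := min δ η
  have hδ' : 0 < δ' := lt_min hδ hη
  obtain ⟨n, hn⟩ := hT.exists_measure_generation_lt (ENNReal.ofReal_pos.2 hδ')
  have hnr : ∀ i, n ≤ i → ∀ J ∈ generation C i, μ.real J < δ' := fun i hi J hJ =>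
    (ENNReal.lt_ofReal_iff_toReal_lt (measure_ne_top μ J)).1 (hn i hi J hJ)
  let G := (hT.finite_generation n).toFinset
  have hG : (G : Set (Set X)) = generation C n := (hT.finite_generation n).coe_toFinset
  have hsumG : ∑ I ∈ G, μ.real I = 1 := by
    rw [← hT.measureReal_sUnion_finset hG.le, hG, hT.sUnion_generation]
    simp
  have hGpos : ∀ I ∈ G, 0 < μ.real I ∧ μ.real I < δ' := fun I hI => by
    have hI : I ∈ generation C n := hG ▸ hI
    exact ⟨hT.measureReal_pos hI, hnr n le_rfl I hI⟩
  obtain ⟨A, hAG, hAmono, hAtop, hA⟩ := exists_monotone_sum_near (fun I => μ.real I) hδ' G hGpos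
  let S : ℕ → Finset (Set X) := fun k => A (a k)
  have hSanti : Antitone S := fun i j hij => hAmono (hanti hij)
  have hsub : ∀ k, (S k : Set (Set X)) ⊆ generation C n := fun k => by
    rw [← hG]
    exact_mod_cast hAG (a k)
  have hS : ∀ k, a k - δ' < ∑ I ∈ S k, μ.real I ∧ ∑ I ∈ S k, μ.real I ≤ a k := fun k =>
    hA (a k) (ha_nonneg k) (hsumG ▸ ha_le k)
  have hlast : S (N + 1) = ∅ := by
    by_contra hne
    obtain ⟨J, hJ⟩ := Finset.nonempty_iff_ne_empty.2 hne
    have h1 := (hS (N + 1)).2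
    rw [haN (N + 1) (by omega)] at h1
    have h2 : 0 < ∑ I ∈ S (N + 1), μ.real I :=
      Finset.sum_pos (fun I hI => (hGpos I (hAG _ hI)).1) ⟨J, hJ⟩
    linarith
  have hδη : δ' ≤ η := min_le_right _ _
  have hss : ∀ k ≤ N, S (k + 1) ⊂ S k := fun k hk => by
    refine (hSanti (Nat.le_succ k)).ssubset_of_ne fun h => ?_
    have h1 := (hS k).1
    have h2 := (hS (k + 1)).2
    have h3 := hgap k hk
    rw [h] at h2
    linarith
  -- This gives the innermost union at least two members, and more measure than any set of
  -- generation `n` or later.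
  have hSN : 2 * δ' < ∑ I ∈ S N, μ.real I := by
    have h1 := (hS N).1
    have h3 := hgap N le_rfl
    rw [haN (N + 1) (by omega)] at h3
    linarith
  have hcard : 2 ≤ (S N).card := by
    by_contra! hlt
    have h1 : ∑ I ∈ S N, μ.real I ≤ (S N).card • δ' :=
      Finset.sum_le_card_nsmul _ _ _ fun I hI => (hGpos I (hAG _ hI)).2.le
    have h2 : ((S N).card : ℝ) ≤ 1 := by exact_mod_cast Nat.lt_succ_iff.1 hlt
    rw [nsmul_eq_mul] at h1
    nlinarith
  obtain ⟨𝒯', κ, hchain, hκ⟩ := exists_isChainTree_of_finset (N := N) hT hSanti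
    (by rw [← hG]; exact_mod_cast hAtop (a 0) (by rw [hsumG, ha0])) hlast hss hcard
    (fun i hi J hJ => (hn i hi J hJ).trans (by
      rw [ENNReal.ofReal_lt_iff_lt_toReal hδ'.le (measure_ne_top μ _)]
      change δ' < μ.real _
      rw [hT.measureReal_sUnion_finset (hsub N)]
      linarith))
  refine ⟨𝒯', κ, hchain, fun k => ?_⟩
  rw [hκ k, hT.measureReal_sUnion_finset (hsub k), abs_lt]
  have := hS k
  have hδδ : δ' ≤ δ := min_le_left _ _
  constructor <;> linarith

end Tree

/-! ### Integrals, `A_p` terms and the maximal function on a chain tree. -/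

/-- The integral over `{k ≤ κ}` of a function equal to `x j` on `{κ = j}`, where `a j` is the
measure of `{j ≤ κ}` and `κ ≤ N`. -/
noncomputable def ringSum (N : ℕ) (a x : ℕ → ℝ) (k : ℕ) : ℝ :=
  ∑ j ∈ Finset.Ico k (N + 1), x j * (a j - a (j + 1))

section ChainTree

variable {X : Type*} [MeasurableSpace X] {μ : Measure X} {𝒯 : Set (Set X)} {N : ℕ} {κ : X → ℕ}

theorem IsChainTree.measurableSet_superlevel (hκ : IsChainTree μ 𝒯 N κ) (k : ℕ) :
    MeasurableSet {x | k ≤ κ x} :=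
  hκ.measurable measurableSet_Ici

theorem IsChainTree.measureReal_pos [IsFiniteMeasure μ] (hκ : IsChainTree μ 𝒯 N κ) {k : ℕ}
    (hk : k ≤ N) : 0 < μ.real {x | k ≤ κ x} := by
  obtain ⟨C, hC⟩ := hκ.isTree
  exact ENNReal.toReal_pos (hC.measure_pos _ (hκ.superlevel_mem k hk)).ne' (measure_ne_top μ _)

theorem IsChainTree.measureReal_fiber [IsFiniteMeasure μ] (hκ : IsChainTree μ 𝒯 N κ) (k : ℕ) :
    μ.real {x | κ x = k} = μ.real {x | k ≤ κ x} - μ.real {x | k + 1 ≤ κ x} := by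
  have hsub : {x | k + 1 ≤ κ x} ⊆ {x | k ≤ κ x} := fun x hx => Nat.le_of_succ_le hx
  rw [← measureReal_sdiff hsub (hκ.measurableSet_superlevel (k + 1))]
  congr 1
  ext x
  simp only [Set.mem_ofPred_eq, Set.mem_sdiff]
  omega

theorem IsChainTree.ringSum_nonneg [IsFiniteMeasure μ] (hκ : IsChainTree μ 𝒯 N κ) {x : ℕ → ℝ}
    (hx : ∀ j, 0 ≤ x j) (k : ℕ) : 0 ≤ ringSum N (fun j => μ.real {y | j ≤ κ y}) x k := by
  refine Finset.sum_nonneg fun j _ => mul_nonneg (hx j) ?_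
  rw [← hκ.measureReal_fiber]
  exact measureReal_nonneg

theorem IsChainTree.setLIntegral_superlevel [IsFiniteMeasure μ] (hκ : IsChainTree μ 𝒯 N κ)
    {x : ℕ → ℝ} (hx : ∀ j, 0 ≤ x j) (k : ℕ) :
    ∫⁻ y in {y | k ≤ κ y}, ENNReal.ofReal (x (κ y)) ∂μ =
      ENNReal.ofReal (ringSum N (fun j => μ.real {y | j ≤ κ y}) x k) := by
  have hset : {y | k ≤ κ y} = ⋃ j ∈ Finset.Ico k (N + 1), {y | κ y = j} := by
    ext y
    have := hκ.le y
    simp only [Set.mem_ofPred_eq, Set.mem_iUnion, Finset.mem_Ico, exists_prop]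
    constructor
    · exact fun h => ⟨κ y, by omega, rfl⟩
    · rintro ⟨j, hj, rfl⟩
      exact hj.1
  have hmeas : ∀ j, MeasurableSet {y | κ y = j} := fun j =>
    hκ.measurable (measurableSet_singleton j)
  rw [hset, lintegral_biUnion_finset, ringSum, ENNReal.ofReal_sum_of_nonneg]
  · refine Finset.sum_congr rfl fun j _ => ?_
    rw [setLIntegral_congr_fun (g := fun _ => ENNReal.ofReal (x j)) (hmeas j)
      (fun y (hy : κ y = j) => by simp only [hy]), setLIntegral_const, ENNReal.ofReal_mul (hx j),
      ← hκ.measureReal_fiber, measureReal_def, ENNReal.ofReal_toReal (measure_ne_top μ _)]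
  · intro j _
    rw [← hκ.measureReal_fiber]
    exact mul_nonneg (hx j) measureReal_nonneg
  · intro i _ j _ hij
    refine Set.disjoint_left.2 fun y hy hy' => hij ?_
    exact (hy : κ y = i).symm.trans hy'
  · exact fun j _ => hmeas j

theorem IsChainTree.lintegral_comp [IsFiniteMeasure μ] (hκ : IsChainTree μ 𝒯 N κ)
    {x : ℕ → ℝ} (hx : ∀ j, 0 ≤ x j) :
    ∫⁻ y, ENNReal.ofReal (x (κ y)) ∂μ =
      ENNReal.ofReal (ringSum N (fun j => μ.real {y | j ≤ κ y}) x 0) := by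
  rw [← hκ.setLIntegral_superlevel hx 0]
  simp

theorem IsChainTree.measurable_comp (hκ : IsChainTree μ 𝒯 N κ) (x : ℕ → ℝ) :
    Measurable fun y => x (κ y) :=
  (measurable_of_countable x).comp hκ.measurable

theorem IsChainTree.integrable_comp [IsFiniteMeasure μ] (hκ : IsChainTree μ 𝒯 N κ)
    {x : ℕ → ℝ} (hx : ∀ j, 0 ≤ x j) : Integrable (fun y => x (κ y)) μ := by
  rw [← lintegral_ofReal_ne_top_iff_integrable (hκ.measurable_comp x).aestronglyMeasurable
    (Eventually.of_forall fun y => hx (κ y)), hκ.lintegral_comp hx]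
  exact ENNReal.ofReal_ne_top

theorem IsChainTree.integral_comp [IsFiniteMeasure μ] (hκ : IsChainTree μ 𝒯 N κ)
    {x : ℕ → ℝ} (hx : ∀ j, 0 ≤ x j) :
    ∫ y, x (κ y) ∂μ = ringSum N (fun j => μ.real {y | j ≤ κ y}) x 0 := by
  rw [integral_eq_lintegral_of_nonneg_ae (Eventually.of_forall fun y => hx (κ y))
    (hκ.measurable_comp x).aestronglyMeasurable, hκ.lintegral_comp hx,
    ENNReal.toReal_ofReal (hκ.ringSum_nonneg hx 0)]

theorem setLIntegral_comp_of_ae_eq {G : ℕ → ℝ≥0∞} {I : Set X} {k : ℕ}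
    (hI : ∀ᵐ x ∂μ.restrict I, κ x = k) : ∫⁻ y in I, G (κ y) ∂μ = G k * μ I := by
  rw [← setLIntegral_const]
  exact lintegral_congr_ae (hI.mono fun x hx => by simp only [hx])

/-- A tree set containing `x` contributes either a chain average or a single value `u k`, in both
cases with `k ≤ κ x`; monotonicity of `D` does the rest. -/
theorem IsChainTree.maximal_le [IsFiniteMeasure μ] (hκ : IsChainTree μ 𝒯 N κ) {u D : ℕ → ℝ}
    (hu : ∀ j, 0 ≤ u j) (hD : Monotone D) (hD0 : ∀ j, 0 ≤ D j) (huD : ∀ j ≤ N, u j ≤ D j)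
    (havg : ∀ j ≤ N, ringSum N (fun j => μ.real {y | j ≤ κ y}) u j / μ.real {y | j ≤ κ y} ≤ D j)
    (x : X) : maximal μ 𝒯 (fun y => u (κ y)) x ≤ ENNReal.ofReal (D (κ x)) := by
  refine iSup₂_le fun I hI => iSup_le fun hxI => ?_
  simp only [Real.enorm_of_nonneg (hu _)]
  refine ENNReal.div_le_of_le_mul ?_
  rcases hκ.dichotomy I hI with ⟨k, hk, rfl⟩ | ⟨k, hk, hkI, hae⟩
  · rw [hκ.setLIntegral_superlevel hu,
      ← ENNReal.ofReal_toReal (measure_ne_top μ {x | k ≤ κ x}), ← ENNReal.ofReal_mul (hD0 _)]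
    refine ENNReal.ofReal_le_ofReal ?_
    have hpos := hκ.measureReal_pos hk
    exact (div_le_iff₀ hpos).1 ((havg k hk).trans (hD hxI))
  · rw [setLIntegral_comp_of_ae_eq (G := fun n => ENNReal.ofReal (u n)) hae]
    gcongr
    exact (huD k hk).trans (hD (hkI x hxI))

theorem IsChainTree.le_maximal [IsFiniteMeasure μ] (hκ : IsChainTree μ 𝒯 N κ) {u : ℕ → ℝ}
    (hu : ∀ j, 0 ≤ u j) (x : X) :
    ENNReal.ofReal (ringSum N (fun j => μ.real {y | j ≤ κ y}) u (κ x) / μ.real {y | κ x ≤ κ y}) ≤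
      maximal μ 𝒯 (fun y => u (κ y)) x := by
  have hpos := hκ.measureReal_pos (hκ.le x)
  refine le_trans ?_ (le_iSup₂_of_le _ (hκ.superlevel_mem (κ x) (hκ.le x))
    (le_iSup_of_le (show x ∈ {y | κ x ≤ κ y} from le_refl (κ x)) le_rfl))
  simp only [Real.enorm_of_nonneg (hu _)]
  rw [hκ.setLIntegral_superlevel hu, ENNReal.ofReal_div_of_pos hpos, measureReal_def,
    ENNReal.ofReal_toReal (measure_ne_top μ _)]

theorem IsChainTree.apTerm_superlevel [IsFiniteMeasure μ] (hκ : IsChainTree μ 𝒯 N κ) {v : ℕ → ℝ}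
    (hv : ∀ j, 0 < v j) {p : ℝ} (hp : 1 < p) {k : ℕ} (hk : k ≤ N) :
    (∫⁻ x in {y | k ≤ κ y}, ENNReal.ofReal (v (κ x)) ∂μ) *
      (∫⁻ x in {y | k ≤ κ y}, ENNReal.ofReal (v (κ x) ^ (-(1 / (p - 1)))) ∂μ) ^ (p - 1) /
        μ {y | k ≤ κ y} ^ p =
    ENNReal.ofReal (ringSum N (fun j => μ.real {y | j ≤ κ y}) v k *
      ringSum N (fun j => μ.real {y | j ≤ κ y}) (fun j => v j ^ (-(1 / (p - 1)))) k ^ (p - 1) /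
        μ.real {y | k ≤ κ y} ^ p) := by
  have hpos := hκ.measureReal_pos hk
  have hv' : ∀ j, 0 ≤ v j ^ (-(1 / (p - 1))) := fun j => Real.rpow_nonneg (hv j).le _
  rw [hκ.setLIntegral_superlevel (fun j => (hv j).le), hκ.setLIntegral_superlevel hv',
    ENNReal.ofReal_div_of_pos (Real.rpow_pos_of_pos hpos p),
    ENNReal.ofReal_mul (hκ.ringSum_nonneg (fun j => (hv j).le) k),
    ← ENNReal.ofReal_rpow_of_nonneg (hκ.ringSum_nonneg hv' k) (by linarith),
    ← ENNReal.ofReal_rpow_of_pos hpos, measureReal_def,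
    ENNReal.ofReal_toReal (measure_ne_top μ _)]

/-- Only the chain sets matter: on every other set the weight is almost everywhere constant, and its
`A_p` term is at most `1 ≤ H`. -/
theorem IsChainTree.apConst_le [IsFiniteMeasure μ] (hκ : IsChainTree μ 𝒯 N κ) {v : ℕ → ℝ}
    (hv : ∀ j, 0 < v j) {p H : ℝ} (hp : 1 < p) (hH : 1 ≤ H)
    (hle : ∀ k ≤ N, ringSum N (fun j => μ.real {y | j ≤ κ y}) v k *
      ringSum N (fun j => μ.real {y | j ≤ κ y}) (fun j => v j ^ (-(1 / (p - 1)))) k ^ (p - 1) /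
        μ.real {y | k ≤ κ y} ^ p ≤ H) :
    apConst μ 𝒯 p (fun x => v (κ x)) ≤ ENNReal.ofReal H := by
  refine iSup₂_le fun I hI => ?_
  rcases hκ.dichotomy I hI with ⟨k, hk, rfl⟩ | ⟨k, hk, hkI, hae⟩
  · rw [hκ.apTerm_superlevel hv hp hk]
    exact ENNReal.ofReal_le_ofReal (hle k hk)
  · rw [setLIntegral_comp_of_ae_eq (G := fun n => ENNReal.ofReal (v n)) hae,
      setLIntegral_comp_of_ae_eq (G := fun n => ENNReal.ofReal (v n ^ (-(1 / (p - 1))))) hae]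
    have hp0 : p - 1 ≠ 0 := by linarith
    have h1 : ENNReal.ofReal (v k) * ENNReal.ofReal (v k ^ (-(1 / (p - 1)))) ^ (p - 1) = 1 := by
      rw [ENNReal.ofReal_rpow_of_pos (Real.rpow_pos_of_pos (hv k) _),
        ← Real.rpow_mul (hv k).le, ← ENNReal.ofReal_mul (hv k).le,
        show -(1 / (p - 1)) * (p - 1) = -1 by field_simp, Real.rpow_neg_one,
        mul_inv_cancel₀ (hv k).ne', ENNReal.ofReal_one]
    refine le_trans (ENNReal.div_le_of_le_mul ?_) (ENNReal.one_le_ofReal.2 hH)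
    rw [ENNReal.mul_rpow_of_nonneg _ _ (by linarith), mul_mul_mul_comm, h1, one_mul, one_mul]
    rw [show p = 1 + (p - 1) by ring, ENNReal.rpow_add_of_nonneg _ _ zero_le_one (by linarith),
      ENNReal.rpow_one, show 1 + (p - 1) - 1 = p - 1 by ring]

theorem IsChainTree.le_apConst [IsFiniteMeasure μ] (hκ : IsChainTree μ 𝒯 N κ) {v : ℕ → ℝ}
    (hv : ∀ j, 0 < v j) {p : ℝ} (hp : 1 < p) {k : ℕ} (hk : k ≤ N) :
    ENNReal.ofReal (ringSum N (fun j => μ.real {y | j ≤ κ y}) v k *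
      ringSum N (fun j => μ.real {y | j ≤ κ y}) (fun j => v j ^ (-(1 / (p - 1)))) k ^ (p - 1) /
        μ.real {y | k ≤ κ y} ^ p) ≤ apConst μ 𝒯 p (fun x => v (κ x)) := by
  rw [← hκ.apTerm_superlevel hv hp hk]
  exact le_iSup₂ (f := fun I (_ : I ∈ 𝒯) => (∫⁻ x in I, ENNReal.ofReal (v (κ x)) ∂μ) *
    (∫⁻ x in I, ENNReal.ofReal (v (κ x) ^ (-(1 / (p - 1)))) ∂μ) ^ (p - 1) / μ I ^ p) _
    (hκ.superlevel_mem k hk)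

theorem IsChainTree.lintegral_maximal_le [IsFiniteMeasure μ] (hκ : IsChainTree μ 𝒯 N κ)
    {u v D : ℕ → ℝ} (hu : ∀ j, 0 ≤ u j) (hv : ∀ j, 0 ≤ v j) (hD : Monotone D)
    (hD0 : ∀ j, 0 ≤ D j) (huD : ∀ j ≤ N, u j ≤ D j)
    (havg : ∀ j ≤ N, ringSum N (fun j => μ.real {y | j ≤ κ y}) u j / μ.real {y | j ≤ κ y} ≤ D j)
    {p : ℝ} (hp : 0 ≤ p) :
    ∫⁻ x, maximal μ 𝒯 (fun y => u (κ y)) x ^ p * ENNReal.ofReal (v (κ x)) ∂μ ≤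
      ENNReal.ofReal (ringSum N (fun j => μ.real {y | j ≤ κ y}) (fun j => D j ^ p * v j) 0) := by
  rw [← hκ.lintegral_comp fun j => mul_nonneg (Real.rpow_nonneg (hD0 j) p) (hv j)]
  refine lintegral_mono fun x => ?_
  rw [ENNReal.ofReal_mul (Real.rpow_nonneg (hD0 _) p), ← ENNReal.ofReal_rpow_of_nonneg (hD0 _) hp]
  gcongr
  exact hκ.maximal_le hu hD hD0 huD havg x

theorem IsChainTree.le_lintegral_maximal [IsFiniteMeasure μ] (hκ : IsChainTree μ 𝒯 N κ)
    {u v : ℕ → ℝ} (hu : ∀ j, 0 ≤ u j) (hv : ∀ j, 0 ≤ v j) {p : ℝ} (hp : 0 ≤ p) :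
    ENNReal.ofReal (ringSum N (fun j => μ.real {y | j ≤ κ y}) (fun j =>
      (ringSum N (fun j => μ.real {y | j ≤ κ y}) u j / μ.real {y | j ≤ κ y}) ^ p * v j) 0) ≤
      ∫⁻ x, maximal μ 𝒯 (fun y => u (κ y)) x ^ p * ENNReal.ofReal (v (κ x)) ∂μ := by
  have h0 : ∀ j, 0 ≤ ringSum N (fun j => μ.real {y | j ≤ κ y}) u j / μ.real {y | j ≤ κ y} :=
    fun j => div_nonneg (hκ.ringSum_nonneg hu j) measureReal_nonneg
  rw [← hκ.lintegral_comp fun j => mul_nonneg (Real.rpow_nonneg (h0 j) p) (hv j)]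
  refine lintegral_mono fun x => ?_
  rw [ENNReal.ofReal_mul (Real.rpow_nonneg (h0 _) p), ← ENNReal.ofReal_rpow_of_nonneg (h0 _) hp]
  gcongr
  exact hκ.le_maximal hu x

end ChainTree

/-! ### Discrete power functions on a geometric chain. -/

/-- The difference quotient of `x ↦ x ^ e` between `r` and `1`. -/
noncomputable def powSlope (e r : ℝ) : ℝ := (1 - r ^ e) / (1 - r)

theorem powSlope_pos {e r : ℝ} (he : 0 < e) (hr0 : 0 < r) (hr1 : r < 1) : 0 < powSlope e r :=
  div_pos (sub_pos.2 (Real.rpow_lt_one hr0.le hr1 he)) (sub_pos.2 hr1)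

theorem tendsto_powSlope (e : ℝ) : Tendsto (powSlope e) (𝓝[<] 1) (𝓝 e) := by
  have h := (Real.hasDerivAt_rpow_const (x := 1) (p := e) (Or.inl one_ne_zero)).tendsto_slope
  simp only [Real.one_rpow, mul_one] at h
  refine (h.mono_left (nhdsWithin_mono 1 fun x hx => ne_of_lt hx)).congr fun r => ?_
  rw [slope_def_field, powSlope, Real.one_rpow, ← neg_div_neg_eq, neg_sub, neg_sub]

/-- The discrete power function of exponent `e - 1`, on the scales `r ^ j`, with constant `x` on
the rings and `y` on the last set. -/
noncomputable def powStep (N : ℕ) (r e x y : ℝ) (j : ℕ) : ℝ :=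
  (if j < N then x else y) * r ^ ((e - 1) * j)

theorem powStep_pos {N : ℕ} {r e x y : ℝ} (hr : 0 < r) (hx : 0 < x) (hy : 0 < y) (j : ℕ) :
    0 < powStep N r e x y j := by
  unfold powStep
  have := Real.rpow_pos_of_pos hr ((e - 1) * j)
  split_ifs <;> positivity

theorem powStep_mul {N : ℕ} {r e e' x y x' y' : ℝ} (hr : 0 < r) (j : ℕ) :
    powStep N r e x y j * powStep N r e' x' y' j =
      powStep N r (e + e' - 1) (x * x') (y * y') j := by
  unfold powStep
  rw [show (e + e' - 1 - 1) * (j : ℝ) = (e - 1) * j + (e' - 1) * j by ring, Real.rpow_add hr]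
  split_ifs <;> ring

theorem powStep_rpow {N : ℕ} {r e x y : ℝ} (hr : 0 < r) (hx : 0 < x) (hy : 0 < y) (q : ℝ) (j : ℕ) :
    powStep N r e x y j ^ q = powStep N r (q * (e - 1) + 1) (x ^ q) (y ^ q) j := by
  unfold powStep
  rw [show (q * (e - 1) + 1 - 1) * (j : ℝ) = ((e - 1) * j) * q by ring,
    Real.rpow_mul hr.le ((e - 1) * j) q]
  have := Real.rpow_nonneg hr.le ((e - 1) * j)
  split_ifs
  · rw [Real.mul_rpow hx.le this]
  · rw [Real.mul_rpow hy.le this]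

/-- The measures `r ^ k`, `k ≤ N`, of a geometric chain. -/
noncomputable def geomChain (N : ℕ) (r : ℝ) (k : ℕ) : ℝ := if k ≤ N then r ^ (k : ℝ) else 0

theorem geomChain_of_le {N k : ℕ} (r : ℝ) (hk : k ≤ N) : geomChain N r k = r ^ (k : ℝ) :=
  if_pos hk

theorem geomChain_of_lt {N k : ℕ} (r : ℝ) (hk : N < k) : geomChain N r k = 0 :=
  if_neg (not_le.2 hk)

theorem geomChain_zero (N : ℕ) (r : ℝ) : geomChain N r 0 = 1 := by
  simp [geomChain]

theorem geomChain_succ_lt {N k : ℕ} {r : ℝ} (hr0 : 0 < r) (hr1 : r < 1) (hk : k ≤ N) :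
    geomChain N r (k + 1) < geomChain N r k := by
  rw [geomChain_of_le r hk]
  rcases hk.lt_or_eq with hk | rfl
  · rw [geomChain_of_le r hk]
    exact Real.rpow_lt_rpow_of_exponent_gt hr0 hr1 (by push_cast; linarith)
  · rw [geomChain_of_lt r (Nat.lt_succ_self k)]
    exact Real.rpow_pos_of_pos hr0 _

theorem ringSum_congr {N : ℕ} {a x x' : ℕ → ℝ} {k : ℕ} (h : ∀ j ≤ N, x j = x' j) :
    ringSum N a x k = ringSum N a x' k :=
  Finset.sum_congr rfl fun j hj => by
    rw [h j (Nat.lt_succ_iff.1 (Finset.mem_Ico.1 hj).2)]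

/-- The ring at level `j` contributes `x r^(ej) (1 - r) = (x / powSlope e r) (r^(ej) - r^(e(j+1)))`,
which telescopes. The innermost set is not a ring and contributes the last term. -/
theorem ringSum_geomChain {N k : ℕ} {r e x y : ℝ} (hr0 : 0 < r) (hr1 : r < 1) (he : 0 < e)
    (hk : k ≤ N) : ringSum N (geomChain N r) (powStep N r e x y) k =
      x / powSlope e r * (r ^ (e * k) - r ^ (e * N)) + y * r ^ (e * N) := by
  have hc := powSlope_pos he hr0 hr1
  have hsum : ∀ M, k ≤ M → ∑ j ∈ Finset.Ico k M,
      x * r ^ ((e - 1) * j) * (r ^ (j : ℝ) - r ^ ((j + 1 : ℕ) : ℝ)) =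
        x / powSlope e r * (r ^ (e * k) - r ^ (e * M)) := by
    intro M hM
    induction M, hM using Nat.le_induction with
    | base => simp
    | succ M hM ih =>
      rw [Finset.sum_Ico_succ_top hM, ih]
      have h1 : r ^ (e * ((M + 1 : ℕ) : ℝ)) = r ^ (e * M) * r ^ e := by
        rw [← Real.rpow_add hr0]
        push_cast
        ring_nf
      have h2 : r ^ ((M + 1 : ℕ) : ℝ) = r ^ (M : ℝ) * r := by
        rw [← Real.rpow_add_one hr0.ne']
        push_cast
        rfl
      have h3 : r ^ (e * (M : ℝ)) = r ^ ((e - 1) * M) * r ^ (M : ℝ) := by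
        rw [← Real.rpow_add hr0]
        ring_nf
      have h4 : (1 - r ^ e) = powSlope e r * (1 - r) := by
        rw [powSlope, div_mul_cancel₀ _ (sub_pos.2 hr1).ne']
      have h5 : x / powSlope e r * (r ^ (e * (M : ℝ)) * (1 - r ^ e)) =
          x * (r ^ (e * (M : ℝ)) * (1 - r)) := by
        rw [h4]
        field_simp
      rw [h1, h2]
      have h6 : x * r ^ ((e - 1) * M) * (r ^ (M : ℝ) - r ^ (M : ℝ) * r) =
        x * (r ^ (e * (M : ℝ)) * (1 - r)) := by rw [h3]; ring
      rw [h6, ← h5]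
      ring
  rw [ringSum, Finset.sum_Ico_succ_top hk, geomChain_of_le r le_rfl,
    geomChain_of_lt r (Nat.lt_succ_self N), ← hsum N hk]
  congr 1
  · refine Finset.sum_congr rfl fun j hj => ?_
    have hj := (Finset.mem_Ico.1 hj).2
    rw [powStep, if_pos hj, geomChain_of_le r hj.le, geomChain_of_le r hj]
  · rw [powStep, if_neg (lt_irrefl N), sub_zero, mul_assoc, ← Real.rpow_add hr0]
    ring_nf

theorem ringSum_geomChain_zero {N : ℕ} {r e x y : ℝ} (hr0 : 0 < r) (hr1 : r < 1) (he : 0 < e) :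
    ringSum N (geomChain N r) (powStep N r e x y) 0 =
      x / powSlope e r * (1 - r ^ (e * N)) + y * r ^ (e * N) := by
  rw [ringSum_geomChain hr0 hr1 he (Nat.zero_le N)]
  simp

/-- With this ratio between the ring constant and the core constant the truncation at `N` leaves no
error: the averages over the chain are exactly `y r^((e-1)k)`. -/
theorem ringSum_geomChain_powSlope {N k : ℕ} {r e y : ℝ} (hr0 : 0 < r) (hr1 : r < 1) (he : 0 < e)
    (hk : k ≤ N) : ringSum N (geomChain N r) (powStep N r e (y * powSlope e r) y) k =
      y * r ^ (e * k) := by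
  rw [ringSum_geomChain hr0 hr1 he hk, mul_div_cancel_right₀ _ (powSlope_pos he hr0 hr1).ne']
  ring

theorem tendsto_rpow_mul_natCast {r e : ℝ} (hr0 : 0 < r) (hr1 : r < 1) (he : 0 < e) :
    Tendsto (fun N : ℕ => r ^ (e * N)) atTop (𝓝 0) := by
  have h := tendsto_pow_atTop_nhds_zero_of_lt_one (Real.rpow_nonneg hr0.le e)
    (Real.rpow_lt_one hr0.le hr1 he)
  refine h.congr fun N => ?_
  rw [Real.rpow_mul hr0.le, Real.rpow_natCast]

theorem tendsto_ringSum_geomChain {r e x y : ℝ} (hr0 : 0 < r) (hr1 : r < 1) (he : 0 < e) :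
    Tendsto (fun N => ringSum N (geomChain N r) (powStep N r e x y) 0) atTop
      (𝓝 (x / powSlope e r)) := by
  simp only [ringSum_geomChain_zero hr0 hr1 he]
  have h := tendsto_rpow_mul_natCast hr0 hr1 he
  have := ((h.const_sub 1).const_mul (x / powSlope e r)).add (h.const_mul y)
  simpa using this

/-- The `A_p` characteristic on a geometric chain of the discrete power weight is a power of a
convex combination. -/
theorem apTerm_geomChain {N k : ℕ} {r e t z p : ℝ} (hr0 : 0 < r) (hr1 : r < 1) (he : 0 < e)
    (ht : 0 < t) (hz : 0 < z) (hp : 1 < p) (het : e + t * (p - 1) = p) (hk : k ≤ N) :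
    ringSum N (geomChain N r) (powStep N r e (z * powSlope e r) z) k *
      ringSum N (geomChain N r)
        (fun j => powStep N r e (z * powSlope e r) z j ^ (-(1 / (p - 1)))) k ^ (p - 1) /
          geomChain N r k ^ p =
      (powSlope e r ^ (-(1 / (p - 1))) / powSlope t r * (1 - r ^ (t * (N - k))) +
        r ^ (t * (N - k))) ^ (p - 1) := by
  have hc := powSlope_pos he hr0 hr1
  have hct := powSlope_pos ht hr0 hr1
  have hp0 : 0 < p - 1 := by linarith
  have hexp : -(1 / (p - 1)) * (e - 1) + 1 = t := by
    field_simp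
    linarith
  have hθ1 : r ^ (t * ((N : ℝ) - k)) ≤ 1 := by
    refine Real.rpow_le_one hr0.le hr1.le (mul_nonneg ht.le ?_)
    rw [sub_nonneg]
    exact_mod_cast hk
  have hθ0 : 0 < r ^ (t * ((N : ℝ) - k)) := Real.rpow_pos_of_pos hr0 _
  have hQ : 0 < powSlope e r ^ (-(1 / (p - 1))) / powSlope t r :=
    div_pos (Real.rpow_pos_of_pos hc _) hct
  rw [ringSum_geomChain_powSlope hr0 hr1 he hk,
    ringSum_congr fun j _ => powStep_rpow hr0 (mul_pos hz hc) hz (-(1 / (p - 1))) j, hexp,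
    ringSum_geomChain hr0 hr1 ht hk, geomChain_of_le r hk]
  have h1 : r ^ (t * (N : ℝ)) = r ^ (t * k) * r ^ (t * ((N : ℝ) - k)) := by
    rw [← Real.rpow_add hr0]
    ring_nf
  have h2 : (z * powSlope e r) ^ (-(1 / (p - 1))) / powSlope t r *
      (r ^ (t * (k : ℝ)) - r ^ (t * (N : ℝ))) + z ^ (-(1 / (p - 1))) * r ^ (t * (N : ℝ)) =
      z ^ (-(1 / (p - 1))) * (r ^ (t * (k : ℝ)) *
        (powSlope e r ^ (-(1 / (p - 1))) / powSlope t r * (1 - r ^ (t * ((N : ℝ) - k))) +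
          r ^ (t * ((N : ℝ) - k)))) := by
    rw [h1, Real.mul_rpow hz.le hc.le]
    ring
  have hB : 0 ≤ powSlope e r ^ (-(1 / (p - 1))) / powSlope t r *
      (1 - r ^ (t * ((N : ℝ) - k))) + r ^ (t * ((N : ℝ) - k)) :=
    add_nonneg (mul_nonneg hQ.le (sub_nonneg.2 hθ1)) hθ0.le
  have hrk := Real.rpow_pos_of_pos hr0 (t * k)
  rw [h2, Real.mul_rpow (Real.rpow_nonneg hz.le _) (mul_nonneg hrk.le hB),
    Real.mul_rpow hrk.le hB, ← Real.rpow_mul hz.le, ← Real.rpow_mul hr0.le,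
    ← Real.rpow_mul hr0.le, show -(1 / (p - 1)) * (p - 1) = -1 by field_simp,
    show (k : ℝ) * p = e * k + t * k * (p - 1) by
      linear_combination -(k : ℝ) * het,
    Real.rpow_add hr0, Real.rpow_neg_one]
  have := Real.rpow_pos_of_pos hr0 (e * k)
  have := Real.rpow_pos_of_pos hr0 (t * k * (p - 1))
  field_simp

/-- The base is a convex combination of `Q` and `1`, hence at most their maximum, uniformly in `k`
and `N`. -/
theorem apTerm_geomChain_le {N k : ℕ} {r e t z p : ℝ} (hr0 : 0 < r) (hr1 : r < 1) (he : 0 < e)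
    (ht : 0 < t) (hz : 0 < z) (hp : 1 < p) (het : e + t * (p - 1) = p) (hk : k ≤ N) :
    ringSum N (geomChain N r) (powStep N r e (z * powSlope e r) z) k *
      ringSum N (geomChain N r)
        (fun j => powStep N r e (z * powSlope e r) z j ^ (-(1 / (p - 1)))) k ^ (p - 1) /
          geomChain N r k ^ p ≤
      max ((powSlope e r ^ (-(1 / (p - 1))) / powSlope t r) ^ (p - 1)) 1 := by
  rw [apTerm_geomChain hr0 hr1 he ht hz hp het hk]
  set Q := powSlope e r ^ (-(1 / (p - 1))) / powSlope t r
  set θ := r ^ (t * ((N : ℝ) - k))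
  have hp0 : 0 < p - 1 := by linarith
  have hθ1 : θ ≤ 1 := by
    refine Real.rpow_le_one hr0.le hr1.le (mul_nonneg ht.le ?_)
    rw [sub_nonneg]
    exact_mod_cast hk
  have hθ0 : 0 < θ := Real.rpow_pos_of_pos hr0 _
  have hQ : 0 < Q :=
    div_pos (Real.rpow_pos_of_pos (powSlope_pos he hr0 hr1) _) (powSlope_pos ht hr0 hr1)
  have hB : 0 ≤ Q * (1 - θ) + θ := add_nonneg (mul_nonneg hQ.le (sub_nonneg.2 hθ1)) hθ0.le
  rcases le_total Q 1 with h | h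
  · refine le_trans ?_ (le_max_right _ _)
    exact Real.rpow_le_one hB (by nlinarith) hp0.le
  · refine le_trans ?_ (le_max_left _ _)
    exact Real.rpow_le_rpow hB (by nlinarith) hp0.le

theorem tendsto_apTerm_geomChain {r e t z p : ℝ} (hr0 : 0 < r) (hr1 : r < 1) (he : 0 < e)
    (ht : 0 < t) (hz : 0 < z) (hp : 1 < p) (het : e + t * (p - 1) = p) :
    Tendsto (fun N => ringSum N (geomChain N r) (powStep N r e (z * powSlope e r) z) 0 *
      ringSum N (geomChain N r)
        (fun j => powStep N r e (z * powSlope e r) z j ^ (-(1 / (p - 1)))) 0 ^ (p - 1) /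
          geomChain N r 0 ^ p) atTop
      (𝓝 ((powSlope e r ^ (-(1 / (p - 1))) / powSlope t r) ^ (p - 1))) := by
  simp only [apTerm_geomChain hr0 hr1 he ht hz hp het (Nat.zero_le _), Nat.cast_zero, sub_zero]
  have h := tendsto_rpow_mul_natCast hr0 hr1 ht
  have h1 := ((h.const_sub 1).const_mul (powSlope e r ^ (-(1 / (p - 1))) / powSlope t r)).add h
  simp only [sub_zero, mul_one, add_zero] at h1
  exact h1.rpow_const (Or.inr (by linarith))

/-! ### Choice of the ratio and the length of the chain. -/

/-- Every estimate is a strict inequality, so that it survives a small change of the measures `a k`.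
The bound `K` does not depend on `ε`. -/
theorem exists_geomChain_near {p f z h F L eφ ew t : ℝ} (hp : 1 < p) (hf : 0 < f) (hz : 0 < z)
    (hh : 1 ≤ h) (heφ : 0 < eφ) (hew : 0 < ew) (ht : 0 < t) (het : ew + t * (p - 1) = p)
    (heF : 0 < p * (eφ - 1) + ew) (hh' : (ew ^ (-(1 / (p - 1))) / t) ^ (p - 1) = h)
    (hF : (f * eφ) ^ p * (z * ew) / (p * (eφ - 1) + ew) = F)
    (hL : f ^ p * (z * ew) / (p * (eφ - 1) + ew) = L) :
    ∃ K : ℝ, ∀ ε > 0, ∃ (N : ℕ) (a u v D : ℕ → ℝ),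
      (a 0 = 1 ∧ (∀ k ≤ N, a (k + 1) < a k) ∧ ∀ k, N < k → a k = 0) ∧
      (∀ j, 0 < u j) ∧ (∀ j, 0 < v j) ∧ (∀ j, 0 < D j) ∧ Monotone D ∧
      ringSum N a u 0 = f ∧ ringSum N a v 0 = z ∧
      |ringSum N a (fun j => u j ^ p * v j) 0 - F| < ε ∧
      (∀ k ≤ N, ringSum N a v k * ringSum N a (fun j => v j ^ (-(1 / (p - 1)))) k ^ (p - 1) /
        a k ^ p < h + ε) ∧
      h - ε < ringSum N a v 0 * ringSum N a (fun j => v j ^ (-(1 / (p - 1)))) 0 ^ (p - 1) /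
        a 0 ^ p ∧
      L - ε < ringSum N a (fun j => (ringSum N a u j / a j) ^ p * v j) 0 ∧
      (∀ k ≤ N, ringSum N a u k / a k < D k) ∧ (∀ k ≤ N, u k < D k) ∧
      ringSum N a (fun j => D j ^ p * v j) 0 < K := by
  have hp0 : 0 < p - 1 := by linarith
  -- The majorant `D` must increase towards the core. If `eφ ≤ 1` it follows the power of `φ`; if
  -- `eφ > 1`, where `φ` decays towards the core, it is constant. The exponent `eD` of `D^p w` is
  -- accordingly `p (eφ - 1) + ew` or `ew`, positive in both cases.
  set b : ℝ := max (1 - eφ) 0 with hb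
  have hb0 : 0 ≤ b := le_max_right _ _
  have hbφ : -b ≤ eφ - 1 := by
    have := le_max_left (1 - eφ) 0
    linarith
  set eD : ℝ := ew - p * b with heD'
  have heD : 0 < eD := by
    rw [heD', hb]
    rcases max_choice (1 - eφ) 0 with h | h <;> rw [h] <;> linarith
  -- Strictly larger than `f` and than `f * powSlope eφ r` for `r` near `1`, so `D` dominates both
  -- the averages and the values of `φ`.
  set M : ℝ := f * (eφ + 2) with hM'
  have hM : 0 < M := by positivity
  have hfM : f < M := lt_mul_of_one_lt_right hf (by linarith)
  -- Of the `2`, one unit absorbs the error of the quotient of slopes and the other the contribution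
  -- of the core.
  refine ⟨M ^ p * z * (ew / eD + 2), fun ε hε => ?_⟩
  have hcφ := tendsto_powSlope eφ
  have hcw := tendsto_powSlope ew
  have hct := tendsto_powSlope t
  have hcF := tendsto_powSlope (p * (eφ - 1) + ew)
  have hcD := tendsto_powSlope eD
  have hr1 : ∀ᶠ r : ℝ in 𝓝[<] 1, r < 1 := self_mem_nhdsWithin
  have hr0 : ∀ᶠ r : ℝ in 𝓝[<] 1, 0 < r :=
    mem_nhdsWithin_of_mem_nhds (lt_mem_nhds zero_lt_one)
  have hφ : ∀ᶠ r in 𝓝[<] 1, powSlope eφ r < eφ + 1 :=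
    hcφ.eventually (gt_mem_nhds (by linarith))
  have hD : ∀ᶠ r in 𝓝[<] 1, powSlope ew r / powSlope eD r < ew / eD + 1 :=
    (hcw.div hcD heD.ne').eventually (gt_mem_nhds (by linarith))
  have hFr : Tendsto (fun r => (f * powSlope eφ r) ^ p * (z * powSlope ew r) /
      powSlope (p * (eφ - 1) + ew) r) (𝓝[<] 1) (𝓝 F) := by
    rw [← hF]
    exact (((hcφ.const_mul f).rpow_const (Or.inr (by linarith))).mul (hcw.const_mul z)).div hcF
      heF.ne'
  have hLr : Tendsto (fun r => f ^ p * (z * powSlope ew r) /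
      powSlope (p * (eφ - 1) + ew) r) (𝓝[<] 1) (𝓝 L) := by
    rw [← hL]
    exact ((hcw.const_mul z).const_mul (f ^ p)).div hcF heF.ne'
  have hQr : Tendsto (fun r => (powSlope ew r ^ (-(1 / (p - 1))) / powSlope t r) ^ (p - 1))
      (𝓝[<] 1) (𝓝 h) := by
    rw [← hh']
    exact ((hcw.rpow_const (Or.inl hew.ne')).div hct ht.ne').rpow_const (Or.inr hp0.le)
  obtain ⟨r, hr1, hr0, hφ, hD, hFr, hLr, hQr, hQr'⟩ := (hr1.and <| hr0.and <| hφ.and <| hD.and <|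
    (hFr.eventually (Metric.ball_mem_nhds F hε)).and <|
    (hLr.eventually (lt_mem_nhds (show L - ε < L by linarith))).and <|
    (hQr.eventually (lt_mem_nhds (show h - ε < h by linarith))).and
    (hQr.eventually (gt_mem_nhds (show h < h + ε by linarith)))).exists
  have hcφ0 := powSlope_pos heφ hr0 hr1
  have hcw0 := powSlope_pos hew hr0 hr1
  have heF1 : p * (eφ - 1) + 1 + ew - 1 = p * (eφ - 1) + ew := by ring
  have heD1 : p * ((1 - b) - 1) + 1 + ew - 1 = eD := by rw [heD']; ring
  have hFN := tendsto_ringSum_geomChain (x := (f * powSlope eφ r) ^ p * (z * powSlope ew r))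
    (y := f ^ p * z) hr0 hr1 heF
  have hLN := tendsto_ringSum_geomChain (x := f ^ p * (z * powSlope ew r))
    (y := f ^ p * z) hr0 hr1 heF
  have hQN := tendsto_apTerm_geomChain hr0 hr1 hew ht hz hp het
  -- The ratio `r` is already fixed; `N` is now taken large enough for the core to be negligible.
  obtain ⟨N, hFN, hLN, hQN⟩ := ((hFN.eventually (Metric.isOpen_ball.mem_nhds hFr)).and <|
    (hLN.eventually (lt_mem_nhds hLr)).and (hQN.eventually (lt_mem_nhds hQr))).exists
  have hfp : ∀ j : ℕ, r ^ ((eφ - 1) * j) ≤ r ^ ((1 - b - 1) * (j : ℝ)) := fun j =>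
    Real.rpow_le_rpow_of_exponent_ge hr0 hr1.le
      (mul_le_mul_of_nonneg_right (by linarith) (Nat.cast_nonneg j))
  have hDj : ∀ j, powStep N r (1 - b) M M j = M * r ^ ((1 - b - 1) * (j : ℝ)) := fun j => by
    simp [powStep]
  have hDlt : ∀ (x : ℝ) (j : ℕ), x < M → 0 < x →
      x * r ^ ((eφ - 1) * j) < powStep N r (1 - b) M M j := fun x j hx hx0 => by
    rw [hDj]
    exact (mul_le_mul_of_nonneg_left (hfp j) hx0.le).trans_lt
      (mul_lt_mul_of_pos_right hx (Real.rpow_pos_of_pos hr0 _))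
  have havg : ∀ k ≤ N, ringSum N (geomChain N r) (powStep N r eφ (f * powSlope eφ r) f) k /
      geomChain N r k = powStep N r eφ f f k := fun k hk => by
    rw [ringSum_geomChain_powSlope hr0 hr1 heφ hk, geomChain_of_le r hk, mul_div_assoc,
      ← Real.rpow_sub hr0, powStep, ite_self]
    ring_nf
  refine ⟨N, geomChain N r, powStep N r eφ (f * powSlope eφ r) f,
    powStep N r ew (z * powSlope ew r) z, powStep N r (1 - b) M M,
    ⟨geomChain_zero N r, fun k hk => geomChain_succ_lt hr0 hr1 hk,
      fun k hk => geomChain_of_lt r hk⟩,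
    powStep_pos hr0 (by positivity) hf, powStep_pos hr0 (by positivity) hz,
    powStep_pos hr0 hM hM, ?_, ?_, ?_, ?_, ?_, hQN, ?_, ?_, ?_, ?_⟩
  · intro i j hij
    rw [hDj, hDj]
    refine mul_le_mul_of_nonneg_left (Real.rpow_le_rpow_of_exponent_ge hr0 hr1.le ?_) hM.le
    have : (i : ℝ) ≤ j := by exact_mod_cast hij
    nlinarith
  · rw [ringSum_geomChain_powSlope hr0 hr1 heφ (Nat.zero_le N)]
    simp
  · rw [ringSum_geomChain_powSlope hr0 hr1 hew (Nat.zero_le N)]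
    simp
  · rw [ringSum_congr fun j _ => by
      rw [powStep_rpow hr0 (by positivity) hf, powStep_mul hr0, heF1]]
    exact hFN
  · intro k hk
    exact (apTerm_geomChain_le hr0 hr1 hew ht hz hp het hk).trans_lt
      (max_lt hQr' (by linarith))
  · rw [ringSum_congr fun j hj => by
      rw [havg j hj, powStep_rpow hr0 hf hf, powStep_mul hr0, heF1]]
    exact hLN
  · intro k hk
    rw [havg k hk, powStep, ite_self]
    exact hDlt f k hfM hf
  · intro k hk
    rw [powStep]
    refine hDlt _ k ?_ ?_
    · split_ifs
      · exact mul_lt_mul_of_pos_left (by linarith) hf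
      · exact hfM
    · split_ifs <;> positivity
  · rw [ringSum_congr fun j _ => by
      rw [powStep_rpow hr0 hM hM, powStep_mul hr0, heD1],
      ringSum_geomChain_zero hr0 hr1 heD]
    have hθ0 : 0 < r ^ (eD * N) := Real.rpow_pos_of_pos hr0 _
    have hθ1 : r ^ (eD * N) ≤ 1 :=
      Real.rpow_le_one hr0.le hr1.le (mul_nonneg heD.le (Nat.cast_nonneg N))
    have hMz : 0 < M ^ p * z := mul_pos (Real.rpow_pos_of_pos hM p) hz
    have hcD0 := div_pos hcw0 (powSlope_pos heD hr0 hr1)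
    calc M ^ p * (z * powSlope ew r) / powSlope eD r * (1 - r ^ (eD * N)) +
          M ^ p * z * r ^ (eD * N)
        = M ^ p * z * (powSlope ew r / powSlope eD r * (1 - r ^ (eD * N)) + r ^ (eD * N)) := by
          ring
      _ < M ^ p * z * (ew / eD + 2) := by
          refine mul_lt_mul_of_pos_left ?_ hMz
          have := mul_nonneg hcD0.le hθ0.le
          linarith

/-! ### The function `H_p` and its inverse. -/

theorem bellmanH_eq {p t : ℝ} (ht : 0 < t) : bellmanH p t = t ^ (p - 1) * (p - (p - 1) * t) := by
  have h : t ^ p = t ^ (p - 1) * t := by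
    rw [← Real.rpow_add_one ht.ne', sub_add_cancel]
  rw [bellmanH, h]
  ring

theorem continuousOn_bellmanH (p : ℝ) : ContinuousOn (bellmanH p) (Set.Icc 1 (p / (p - 1))) := by
  have hne : ∀ t ∈ Set.Icc 1 (p / (p - 1)), t ≠ 0 := fun t ht => (zero_lt_one.trans_le ht.1).ne'
  unfold bellmanH
  exact (continuousOn_const.mul (continuousOn_id.rpow_const fun t ht => Or.inl (hne t ht))).add
    (continuousOn_const.mul (continuousOn_id.rpow_const fun t ht => Or.inl (hne t ht)))

/-- The intermediate value theorem between `H_p(1) = 1` and `H_p(p/(p-1)) = 0`. Only the existence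
of a preimage is needed, not the monotonicity of `H_p`. -/
theorem omegaP_spec {p y : ℝ} (hp : 1 < p) (hy0 : 0 ≤ y) (hy1 : y ≤ 1) :
    omegaP p y ∈ Set.Icc 1 (p / (p - 1)) ∧ bellmanH p (omegaP p y) = y := by
  have hp0 : 0 < p - 1 := by linarith
  have hle : 1 ≤ p / (p - 1) := by
    rw [le_div_iff₀ hp0]
    linarith
  have h1 : bellmanH p 1 = 1 := by simp [bellmanH]
  have h2 : bellmanH p (p / (p - 1)) = 0 := by
    rw [bellmanH_eq (by linarith), mul_div_cancel₀ _ hp0.ne', sub_self, mul_zero]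
  have himg : y ∈ bellmanH p '' Set.Icc 1 (p / (p - 1)) :=
    intermediate_value_Icc' hle (continuousOn_bellmanH p) (by rw [h1, h2]; exact ⟨hy0, hy1⟩)
  exact ⟨Function.invFunOn_mem himg, Function.invFunOn_eq himg⟩

/-! ### From ideal chains to trees on the space, and passage to the limit. -/

theorem tendsto_ringSum {N : ℕ} {a : ℕ → ℝ} {b x' : ℕ → ℕ → ℝ} {x : ℕ → ℝ}
    (hb : ∀ k, Tendsto (fun i => b i k) atTop (𝓝 (a k)))
    (hx : ∀ k ≤ N, Tendsto (fun i => x' i k) atTop (𝓝 (x k))) (k : ℕ) :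
    Tendsto (fun i => ringSum N (b i) (x' i) k) atTop (𝓝 (ringSum N a x k)) :=
  tendsto_finsetSum _ fun j hj =>
    (hx j (Nat.lt_succ_iff.1 (Finset.mem_Ico.1 hj).2)).mul ((hb j).sub (hb (j + 1)))

theorem eventually_forall_le_of_forall {N : ℕ} {P : ℕ → ℕ → Prop}
    (h : ∀ k ≤ N, ∀ᶠ i in atTop, P i k) : ∀ᶠ i in atTop, ∀ k ≤ N, P i k := by
  have := (Finset.eventually_all (Finset.range (N + 1))).2
    fun k hk => h k (Nat.lt_succ_iff.1 (Finset.mem_range.1 hk))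
  exact this.mono fun i hi k hk => hi k (Finset.mem_range.2 (Nat.lt_succ_of_le hk))

section Approximation

variable {X : Type*} [MeasurableSpace X] {μ : Measure X} [IsProbabilityMeasure μ]
  {𝒯₀ : Set (Set X)}

theorem exists_approximation (h𝒯₀ : IsTree μ 𝒯₀) {p f z h F L eφ ew t : ℝ} (hp : 1 < p)
    (hf : 0 < f) (hz : 0 < z) (hh : 1 ≤ h) (heφ : 0 < eφ) (hew : 0 < ew) (ht : 0 < t)
    (het : ew + t * (p - 1) = p) (heF : 0 < p * (eφ - 1) + ew)
    (hh' : (ew ^ (-(1 / (p - 1))) / t) ^ (p - 1) = h)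
    (hF : (f * eφ) ^ p * (z * ew) / (p * (eφ - 1) + ew) = F)
    (hL : f ^ p * (z * ew) / (p * (eφ - 1) + ew) = L) :
    ∃ K : ℝ, ∀ ε > 0, ∃ (𝒯 : Set (Set X)) (φ w : X → ℝ), IsTree μ 𝒯 ∧
      (Measurable φ ∧ (∀ x, 0 < φ x) ∧ Integrable φ μ ∧
        Integrable (fun x => φ x ^ p * w x) μ) ∧
      IsApWeight μ 𝒯 p w ∧
      |∫ x, φ x ∂μ - f| < ε ∧ |∫ x, φ x ^ p * w x ∂μ - F| < ε ∧
      ENNReal.ofReal (h - ε) ≤ apConst μ 𝒯 p w ∧ apConst μ 𝒯 p w ≤ ENNReal.ofReal (h + ε) ∧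
      |∫ x, w x ∂μ - z| < ε ∧
      ENNReal.ofReal (L - ε) ≤ ∫⁻ x, maximal μ 𝒯 φ x ^ p * ENNReal.ofReal (w x) ∂μ ∧
      ∫⁻ x, maximal μ 𝒯 φ x ^ p * ENNReal.ofReal (w x) ∂μ ≤ ENNReal.ofReal K := by
  have hp0 : 0 < p := by linarith
  obtain ⟨K, hK⟩ := exists_geomChain_near hp hf hz hh heφ hew ht het heF hh' hF hL
  refine ⟨K, fun ε hε => ?_⟩
  obtain ⟨N, a, u, v, D, ⟨ha0, ha, haN⟩, hu, hv, hD0, hD, hfu, hzv, hFuv, hap, hap0, hLow, havg,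
    huD, hup⟩ := hK ε hε
  have hpos : ∀ k ≤ N, 0 < a k := fun k hk => by
    rw [← haN (N + 1) (Nat.lt_succ_self N)]
    induction hk using Nat.decreasingInduction with
    | self => exact ha N le_rfl
    | of_succ k hk ih => exact ih.trans (ha k hk.le)
  -- The chain is fixed and only the accuracy `1 / (i + 1)` of its realization varies, so finitely
  -- many continuous conditions hold for large `i`.
  choose 𝒯 κ hκ hκa using fun i : ℕ =>
    exists_isChainTree h𝒯₀ ha0 ha haN (Nat.one_div_pos_of_nat (α := ℝ) (n := i))
  set b : ℕ → ℕ → ℝ := fun i k => μ.real {x | k ≤ κ i x} with hb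
  have hba : ∀ k, Tendsto (fun i => b i k) atTop (𝓝 (a k)) := fun k => by
    rw [tendsto_iff_dist_tendsto_zero]
    exact squeeze_zero (fun _ => dist_nonneg) (fun i => (hκa i k).le)
      tendsto_one_div_add_atTop_nhds_zero_nat
  have hring : ∀ (x : ℕ → ℝ) (k : ℕ),
      Tendsto (fun i => ringSum N (b i) x k) atTop (𝓝 (ringSum N a x k)) := fun x k =>
    tendsto_ringSum (x' := fun _ => x) hba (fun _ _ => tendsto_const_nhds) k
  have havgt : ∀ k ≤ N, Tendsto (fun i => ringSum N (b i) u k / b i k) atTop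
      (𝓝 (ringSum N a u k / a k)) := fun k hk => (hring u k).div (hba k) (hpos k hk).ne'
  have hapt : ∀ k ≤ N, Tendsto (fun i => ringSum N (b i) v k *
      ringSum N (b i) (fun j => v j ^ (-(1 / (p - 1)))) k ^ (p - 1) / b i k ^ p) atTop
      (𝓝 (ringSum N a v k *
        ringSum N a (fun j => v j ^ (-(1 / (p - 1)))) k ^ (p - 1) / a k ^ p)) := fun k hk =>
    ((hring v k).mul ((hring _ k).rpow_const (Or.inr (by linarith)))).div
      ((hba k).rpow_const (Or.inr hp0.le)) (Real.rpow_pos_of_pos (hpos k hk) p).ne'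
  have hLowt := tendsto_ringSum hba (x := fun j => (ringSum N a u j / a j) ^ p * v j)
    (x' := fun i j => (ringSum N (b i) u j / b i j) ^ p * v j)
    (fun k hk => ((havgt k hk).rpow_const (Or.inr hp0.le)).mul_const (v k)) 0
  obtain ⟨i, hi1, hi2, hi3, hi4, hi5, hi6, hi7, hi8⟩ :=
    (((hring u 0).eventually (Metric.ball_mem_nhds _ hε)).and <|
    ((hring v 0).eventually (Metric.ball_mem_nhds _ hε)).and <|
    ((hring (fun j => u j ^ p * v j) 0).eventually
      (Metric.isOpen_ball.mem_nhds (show _ ∈ Metric.ball F ε from hFuv))).and <|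
    (eventually_forall_le_of_forall fun k hk =>
      (hapt k hk).eventually (gt_mem_nhds (hap k hk))).and <|
    ((hapt 0 (Nat.zero_le N)).eventually (lt_mem_nhds hap0)).and <|
    (hLowt.eventually (lt_mem_nhds hLow)).and <|
    (eventually_forall_le_of_forall fun k hk =>
      (havgt k hk).eventually (gt_mem_nhds (havg k hk))).and
    ((hring (fun j => D j ^ p * v j) 0).eventually (gt_mem_nhds hup))).exists
  have huv : ∀ j, 0 ≤ u j ^ p * v j := fun j =>
    mul_nonneg (Real.rpow_nonneg (hu j).le p) (hv j).le
  have hu' : ∀ j, 0 ≤ u j := fun j => (hu j).le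
  have hv' : ∀ j, 0 ≤ v j := fun j => (hv j).le
  have hle : apConst μ (𝒯 i) p (fun x => v (κ i x)) ≤ ENNReal.ofReal (h + ε) :=
    (hκ i).apConst_le hv hp (by linarith) fun k hk => (hi4 k hk).le
  refine ⟨𝒯 i, fun x => u (κ i x), fun x => v (κ i x), (hκ i).isTree,
    ⟨(hκ i).measurable_comp u, fun x => hu _, (hκ i).integrable_comp hu',
      (hκ i).integrable_comp huv⟩,
    ⟨(hκ i).measurable_comp v, fun x => hv _, (hκ i).integrable_comp hv',
      hle.trans_lt ENNReal.ofReal_lt_top⟩, ?_, ?_, ?_, hle, ?_, ?_, ?_⟩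
  · rw [(hκ i).integral_comp hu', ← hfu]
    exact hi1
  · rw [(hκ i).integral_comp huv]
    exact hi3
  · exact (ENNReal.ofReal_le_ofReal hi5.le).trans ((hκ i).le_apConst hv hp (Nat.zero_le N))
  · rw [(hκ i).integral_comp hv', ← hzv]
    exact hi2
  · exact (ENNReal.ofReal_le_ofReal hi6.le).trans ((hκ i).le_lintegral_maximal hu' hv' hp0.le)
  · exact ((hκ i).lintegral_maximal_le hu' hv' hD (fun j => (hD0 j).le)
      (fun j hj => (huD j hj).le) (fun j hj => (hi7 j hj).le) hp0.le).trans
      (ENNReal.ofReal_le_ofReal hi8.le)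

theorem exists_approximating_sequence (h𝒯₀ : IsTree μ 𝒯₀) {p f z h F L eφ ew t : ℝ} (hp : 1 < p)
    (hf : 0 < f) (hz : 0 < z) (hh : 1 ≤ h) (heφ : 0 < eφ) (hew : 0 < ew) (ht : 0 < t)
    (het : ew + t * (p - 1) = p) (heF : 0 < p * (eφ - 1) + ew)
    (hh' : (ew ^ (-(1 / (p - 1))) / t) ^ (p - 1) = h)
    (hF : (f * eφ) ^ p * (z * ew) / (p * (eφ - 1) + ew) = F)
    (hL : f ^ p * (z * ew) / (p * (eφ - 1) + ew) = L) :
    ∃ (𝒯 : ℕ → Set (Set X)) (φ w : ℕ → X → ℝ),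
      (∀ m, IsTree μ (𝒯 m)) ∧
      (∀ m, Measurable (φ m) ∧ (∀ x, 0 < φ m x) ∧ Integrable (φ m) μ ∧
        Integrable (fun x => φ m x ^ p * w m x) μ) ∧
      (∀ m, IsApWeight μ (𝒯 m) p (w m)) ∧
      Tendsto (fun m => ∫ x, φ m x ∂μ) atTop (𝓝 f) ∧
      Tendsto (fun m => ∫ x, φ m x ^ p * w m x ∂μ) atTop (𝓝 F) ∧
      Tendsto (fun m => apConst μ (𝒯 m) p (w m)) atTop (𝓝 (ENNReal.ofReal h)) ∧
      Tendsto (fun m => ∫ x, w m x ∂μ) atTop (𝓝 z) ∧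
      ∃ L' : ℝ,
        Tendsto (fun m => ∫⁻ x, maximal μ (𝒯 m) (φ m) x ^ p * ENNReal.ofReal (w m x) ∂μ) atTop
          (𝓝 (ENNReal.ofReal L')) ∧ L ≤ L' := by
  obtain ⟨K, hK⟩ := exists_approximation (μ := μ) h𝒯₀ hp hf hz hh heφ hew ht het heF hh' hF hL
  choose 𝒯 φ w hT hφ hw hfi hFi hh1 hh2 hzi hL1 hL2 using fun i : ℕ =>
    hK (1 / ((i : ℝ) + 1)) Nat.one_div_pos_of_nat
  have hε := tendsto_one_div_add_atTop_nhds_zero_nat (𝕜 := ℝ)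
  have hlim : ∀ {g : ℕ → ℝ} {c : ℝ}, (∀ i : ℕ, |g i - c| < 1 / ((i : ℝ) + 1)) →
      Tendsto g atTop (𝓝 c) := fun {g c} hg => by
    rw [tendsto_iff_dist_tendsto_zero]
    exact squeeze_zero (fun _ => dist_nonneg) (fun i => (hg i).le) hε
  have hap : Tendsto (fun m => apConst μ (𝒯 m) p (w m)) atTop (𝓝 (ENNReal.ofReal h)) := by
    refine tendsto_of_tendsto_of_tendsto_of_le_of_le
      (g := fun i : ℕ => ENNReal.ofReal (h - 1 / ((i : ℝ) + 1)))
      (h := fun i : ℕ => ENNReal.ofReal (h + 1 / ((i : ℝ) + 1))) ?_ ?_ hh1 hh2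
    · simpa using ENNReal.tendsto_ofReal (hε.const_sub h)
    · simpa using ENNReal.tendsto_ofReal (hε.const_add h)
  -- The integrals of the maximal functions are only known to lie between two bounds. Compactness of
  -- `[0, ∞]` supplies a convergent subsequence, and the uniform bound `K` makes its limit finite.
  obtain ⟨ℓ, θ, hθ, hℓ⟩ := CompactSpace.tendsto_subseq
    fun m => ∫⁻ x, maximal μ (𝒯 m) (φ m) x ^ p * ENNReal.ofReal (w m x) ∂μ
  have hθ' := hθ.tendsto_atTop
  have hℓK : ℓ ≤ ENNReal.ofReal K := le_of_tendsto' hℓ fun i => hL2 (θ i)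
  have hℓtop : ℓ ≠ ∞ := ne_top_of_le_ne_top ENNReal.ofReal_ne_top hℓK
  have hLℓ : ENNReal.ofReal L ≤ ℓ := by
    have h1 : Tendsto (fun i : ℕ => ENNReal.ofReal (L - 1 / ((i : ℝ) + 1))) atTop
        (𝓝 (ENNReal.ofReal L)) := by
      simpa using ENNReal.tendsto_ofReal (hε.const_sub L)
    exact le_of_tendsto_of_tendsto' (h1.comp hθ') hℓ fun i => hL1 (θ i)
  refine ⟨fun m => 𝒯 (θ m), fun m => φ (θ m), fun m => w (θ m), fun m => hT _, fun m => hφ _,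
    fun m => hw _, (hlim hfi).comp hθ', (hlim hFi).comp hθ', hap.comp hθ', (hlim hzi).comp hθ',
    ℓ.toReal, ?_, (ENNReal.ofReal_le_iff_le_toReal hℓtop).1 hLℓ⟩
  rw [ENNReal.ofReal_toReal hℓtop]
  exact hℓ

end Approximation

end DyadicLike

/-! ### The choice of exponents. -/

theorem proposition2 {X : Type*} [MeasurableSpace X] (μ : Measure X) [IsProbabilityMeasure μ]
    (𝒯₀ : Set (Set X)) (h𝒯₀ : DyadicLike.IsTree μ 𝒯₀)
    (p : ℝ) (hp : 1 < p) (F f h z : ℝ) (hF : 0 < F) (hf : 0 < f) (hh : 1 ≤ h) (hz : 0 < z)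
    (hdom : z * f ^ p ≤ h * F) :
    ∃ (𝒯 : ℕ → Set (Set X)) (φ w : ℕ → X → ℝ),
      (∀ m, DyadicLike.IsTree μ (𝒯 m)) ∧
      (∀ m, Measurable (φ m) ∧ (∀ x, 0 < φ m x) ∧ Integrable (φ m) μ ∧
        Integrable (fun x => φ m x ^ p * w m x) μ) ∧
      (∀ m, DyadicLike.IsApWeight μ (𝒯 m) p (w m)) ∧
      Tendsto (fun m => ∫ x, φ m x ∂μ) atTop (𝓝 f) ∧
      Tendsto (fun m => ∫ x, φ m x ^ p * w m x ∂μ) atTop (𝓝 F) ∧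
      Tendsto (fun m => DyadicLike.apConst μ (𝒯 m) p (w m)) atTop (𝓝 (ENNReal.ofReal h)) ∧
      Tendsto (fun m => ∫ x, w m x ∂μ) atTop (𝓝 z) ∧
      ∃ L : ℝ,
        Tendsto (fun m => ∫⁻ x, DyadicLike.maximal μ (𝒯 m) (φ m) x ^ p *
          ENNReal.ofReal (w m x) ∂μ) atTop (𝓝 (ENNReal.ofReal L)) ∧
        F * DyadicLike.omegaP p (z * f ^ p / (h * F)) ^ p * DyadicLike.omegaP p (1 / h) ^ (-p) ≤ L := by
  have hp0 : 0 < p - 1 := by linarith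
  have hh0 : 0 < h := by linarith
  have hfp : 0 < f ^ p := Real.rpow_pos_of_pos hf p
  have hy : 0 < z * f ^ p / (h * F) := by positivity
  have hy' : 0 < 1 / h := by positivity
  obtain ⟨hs, hHs⟩ := DyadicLike.omegaP_spec hp hy.le (div_le_one_of_le₀ hdom (by positivity))
  obtain ⟨ht, hHt⟩ := DyadicLike.omegaP_spec hp hy'.le (div_le_one_of_le₀ hh hh0.le)
  generalize DyadicLike.omegaP p (z * f ^ p / (h * F)) = s at *
  generalize DyadicLike.omegaP p (1 / h) = t at *
  have hs0 : 0 < s := by linarith [hs.1]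
  have ht0 : 0 < t := by linarith [ht.1]
  rw [DyadicLike.bellmanH_eq hs0] at hHs
  rw [DyadicLike.bellmanH_eq ht0] at hHt
  have hsp := Real.rpow_pos_of_pos hs0 (p - 1)
  have htp := Real.rpow_pos_of_pos ht0 (p - 1)
  -- Since `H_p(s)` and `H_p(t)` are strictly positive, neither root is the endpoint `p / (p - 1)`;
  -- hence the exponents are positive and the power functions integrable.
  have hes : 0 < p - (p - 1) * s := pos_of_mul_pos_right (hHs ▸ hy) hsp.le
  have het : 0 < p - (p - 1) * t := pos_of_mul_pos_right (hHt ▸ hy') htp.le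
  have heF : p * (t / s - 1) + (p - (p - 1) * t) = t / s * (p - (p - 1) * s) := by
    field_simp
    ring
  have hL : f ^ p * (z * (p - (p - 1) * t)) / (p * (t / s - 1) + (p - (p - 1) * t)) =
      F * s ^ p * t ^ (-p) := by
    have h1 : s ^ p = s ^ (p - 1) * s := by rw [← Real.rpow_add_one hs0.ne', sub_add_cancel]
    have h2 : t ^ p = t ^ (p - 1) * t := by rw [← Real.rpow_add_one ht0.ne', sub_add_cancel]
    rw [heF, Real.rpow_neg ht0.le, h1, h2]
    have h3 : p - (p - 1) * t = 1 / h / t ^ (p - 1) := by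
      rw [← hHt, mul_div_cancel_left₀ _ htp.ne']
    have h4 : p - (p - 1) * s = z * f ^ p / (h * F) / s ^ (p - 1) := by
      rw [← hHs, mul_div_cancel_left₀ _ hsp.ne']
    rw [h3, h4]
    field_simp
  -- The exponents are `eφ = t / s` and `ew = p - (p - 1) t`, with `t` itself the exponent of the
  -- dual weight.
  refine DyadicLike.exists_approximating_sequence h𝒯₀ hp hf hz hh (div_pos ht0 hs0) het ht0
    (by ring) (heF ▸ mul_pos (div_pos ht0 hs0) hes) ?_ ?_ hL
  · rw [Real.div_rpow (Real.rpow_nonneg het.le _) ht0.le, ← Real.rpow_mul het.le,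
      show -(1 / (p - 1)) * (p - 1) = -1 by field_simp, Real.rpow_neg_one, div_eq_mul_inv,
      ← mul_inv, mul_comm, hHt, one_div, inv_inv]
  · have h1 : (f * (t / s)) ^ p * (z * (p - (p - 1) * t)) /
        (p * (t / s - 1) + (p - (p - 1) * t)) = (t / s) ^ p * (f ^ p * (z * (p - (p - 1) * t)) /
        (p * (t / s - 1) + (p - (p - 1) * t))) := by
      rw [Real.mul_rpow hf.le (div_pos ht0 hs0).le]
      ring
    rw [h1, hL, Real.div_rpow ht0.le hs0.le, Real.rpow_neg ht0.le]
    have := Real.rpow_pos_of_pos hs0 p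
    have := Real.rpow_pos_of_pos ht0 p
    field_simp
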